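/- Let $\rho,\alpha\in(0,1)$. A lender with discount factor $\rho$ faces a consumer whose periodic income $\theta$ is drawn once from the symmetric Beta distribution $\mathrm{Beta}(a,a)$, $a>0$, which has mean $\tfrac12$ and variance $v(a)=\frac{1}{4(2a+1)}\in(0,\tfrac14)$, and is unknown to the lender. In each period $t=0,1,2,\dots$ in which the consumer is still in the system, the lender offers a repayment amount $y_t\ge 0$ at a discount rate $d_t\in[0,\rho]$. The consumer accepts with probability $s(d_t)=d_t^{\alpha}$ (constant demand elasticity $d\,s'(d)/s(d)=\alpha$) and leaves otherwise; if she accepts, she receives $d_ty_t$ and, one period later, pays back $y_t$ if $\theta\ge y_t$, while if $\theta<y_t$ she pays nothing and leaves. The lender's expected NPV under the policy $(\mathbf y,\mathbf d)$ is $$\Pi_a(\mathbf y,\mathbf d)=\sum_{t=0}^{\infty}\rho^{t}\Big[\prod_{i<t}P_i\,s(d_i)\Big]\big(\rho\, s(d_t)P_t\,y_t-s(d_t)\,d_t\,y_t\big),\qquad P_t=\mathbb P_a\big(\theta\ge y_t \,\big|\, \theta\ge y_i\text{ for all } i<t\big),$$ where $P_t$ is read as $0$ if the conditioning event has probability $0$.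 This series always converges. For every $a>0$ the maximum $V(a)=\max_{(\mathbf y,\mathbf d)}\Pi_a(\mathbf y,\mathbf d)$ over all policies is attained. Moreover $V$ is U-shaped as a function of the income variance: there is $v_0\in(0,\tfrac14)$ such that, as the variance $v(a)=\frac{1}{4(2a+1)}$ increases, $V$ is strictly decreasing for variances in $(0,v_0]$ and strictly increasing for variances in $[v_0,\tfrac14)$. -/

import Mathlib

open MeasureTheory ProbabilityTheory

noncomputable section

/-- A dynamic lending policy of a lender with discount factor `ρ`: in period `t`, a consumer who is
still in the system is offered a loan with repayment amount `repay t` at the discount rate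
`disc t`, that is, a loan of size `disc t * repay t`. -/
structure LendingPolicy (ρ : ℝ) where
  repay : ℕ → ℝ
  disc : ℕ → ℝ
  repay_nonneg : ∀ t, 0 ≤ repay t
  disc_mem : ∀ t, disc t ∈ Set.Icc 0 ρ

namespace LendingPolicy

variable {ρ : ℝ}

/-- The incomes compatible with the history at time `t` of a consumer who has repaid all the
loans of the periods before `t`. -/
def history (p : LendingPolicy ρ) (t : ℕ) : Set ℝ :=
  {θ | ∀ i < t, p.repay i ≤ θ}

/-- The conditional probability, given the history at time `t`, that the income, which has
law `μ`, suffices to repay the loan of period `t`. -/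
def repayProb (p : LendingPolicy ρ) (μ : Measure ℝ) (t : ℕ) : ℝ :=
  (cond μ (p.history t)).real (Set.Ici (p.repay t))

/-- The discounted expected cash flow of the loan of period `t`, for the demand function `s`: with
probability `∏ i < t, repayProb i * s (disc i)` the consumer is still in the system; she accepts
the loan with probability `s (disc t)`, in which case the lender pays `disc t * repay t` now and
receives `repay t` one period later if the income suffices, and nothing otherwise. -/
def cashFlow (p : LendingPolicy ρ) (s : ℝ → ℝ) (μ : Measure ℝ) (t : ℕ) : ℝ :=
  ρ ^ t * (∏ i ∈ Finset.range t, p.repayProb μ i * s (p.disc i)) *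
    (ρ * s (p.disc t) * p.repayProb μ t * p.repay t
      - s (p.disc t) * p.disc t * p.repay t)

/-- The lender's expected net present value under the policy. -/
def expectedNPV (p : LendingPolicy ρ) (s : ℝ → ℝ) (μ : Measure ℝ) : ℝ :=
  ∑' t, p.cashFlow s μ t

end LendingPolicy

/-- The lender's optimal expected net present value. -/
def optimalNPV (ρ : ℝ) (s : ℝ → ℝ) (μ : Measure ℝ) : ℝ :=
  ⨆ p : LendingPolicy ρ, p.expectedNPV s μ

/-- The demand function with constant elasticity `α`: `d * s' d / s d = α`, with `s 1 = 1`. -/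
def constElasticityDemand (α : ℝ) : ℝ → ℝ := fun d => d ^ α

/-- The symmetric Beta law of income. -/
def symmBeta (a : ℝ) : Measure ℝ := betaMeasure a a

/-- The variance of the symmetric Beta law of income. -/
def incomeVar (a : ℝ) : ℝ := variance id (symmBeta a)

end

/-!
A lender whose customer is known to repay would always offer the same discount rate `δ` and earn
`K` per unit of repayment. Against a random income, every loan below a certain threshold only
screens: it loses money, and the next loan is larger at least by the factor `ρ⁻¹`. So after finitely
many screening loans an optimal policy jumps to a repayment amount which it then keeps for ever, and
this amount is the mode `z` of `y * G y ^ (1 + α)`, where `G` is the survival function of income.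
Hence the optimal value is an affine functional of `G`, with a positive coefficient at `G z` and
negative ones at points below the threshold; as the policy is feasible for every other law, the
same affine functional is a lower bound for the optimal value of that law. Values of different laws
can therefore be compared through their survival functions.

For the symmetric Beta laws, if `z ≥ 1/2`, more dispersion raises `G z` relative to every `G y` with
`y < z`, and so raises the value. If `z < 1/2`, then, by counting sign changes of densities, some
convex combination of a more and a less dispersed survival function is below `G` up to the
threshold and above `G` at `z`, so that one of these two laws has a larger value. Very dispersed
laws have `z > 1/2`, and for very concentrated ones the value tends to `K / 2`, which is an upper
bound for all of them. Together with lower semicontinuity, which is inherited from the affine lower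
bounds, this leaves only a U shape.
-/

/-! ### Dynamic programming for a continuous survival function -/

section DynamicProgramming

/-- The data of a discounted lending problem: a discount factor `ρ` and a demand function `s`,
continuous and with values in `[0, 1]` at the discount rates in `[0, ρ]`. -/
structure IsLendingMarket (ρ : ℝ) (s : ℝ → ℝ) : Prop where
  rho_nonneg : 0 ≤ ρ
  rho_lt_one : ρ < 1
  continuousOn : ContinuousOn s (Set.Icc 0 ρ)
  mapsTo : Set.MapsTo s (Set.Icc 0 ρ) (Set.Icc 0 1)

/-- `G y` is the probability of an income of at least `y`, for an atomless law on `[0, 1]`. -/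
structure IsSurvival (G : ℝ → ℝ) : Prop where
  continuous : Continuous G
  antitone : Antitone G
  eq_one : ∀ y ≤ 0, G y = 1
  eq_zero : ∀ y, 1 ≤ y → G y = 0

namespace IsSurvival

variable {G : ℝ → ℝ}

lemma nonneg (hG : IsSurvival G) (y : ℝ) : 0 ≤ G y := by
  rw [← hG.eq_zero (max y 1) (le_max_right _ _)]
  exact hG.antitone (le_max_left _ _)

lemma le_one (hG : IsSurvival G) (y : ℝ) : G y ≤ 1 := by
  rw [← hG.eq_one (min y 0) (min_le_right _ _)]
  exact hG.antitone (min_le_left _ _)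

end IsSurvival

/-- The largest repayment amount before period `t`, starting from the record `m`. All that the
lender learns from the past repayments is that the income is at least the record. -/
def record (m : ℝ) (y : ℕ → ℝ) : ℕ → ℝ
  | 0 => m
  | t + 1 => max (record m y t) (y t)

lemma record_succ_eq_record_tail (m : ℝ) (y : ℕ → ℝ) (t : ℕ) :
    record m y (t + 1) = record (max m (y 0)) (fun i => y (i + 1)) t := by
  induction t with
  | zero => rfl
  | succ t ih => rw [record, ih]; rfl

/-- Plans: sequences of pairs of a repayment amount in `[0, 1]` and a discount rate in `[0, ρ]`.
They form a compact space. -/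
def plans (ρ : ℝ) : Set (ℕ → ℝ × ℝ) :=
  Set.univ.pi fun _ => Set.Icc 0 1 ×ˢ Set.Icc 0 ρ

/-- The expected discounted cash flow of period `t` under the plan `q` when the record is `m`,
not conditioned on that record: it is `G m` times the conditional expectation. This makes it
linear in the survival function `G`. -/
def flow (ρ : ℝ) (s G : ℝ → ℝ) (m : ℝ) (q : ℕ → ℝ × ℝ) (t : ℕ) : ℝ :=
  ρ ^ t * (∏ i ∈ Finset.range (t + 1), s (q i).2) *
    ((q t).1 * (ρ * G (record m (fun i => (q i).1) (t + 1))
      - (q t).2 * G (record m (fun i => (q i).1) t)))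

/-- The value of the plan `q` from the record `m` on. -/
noncomputable def planValue (ρ : ℝ) (s G : ℝ → ℝ) (m : ℝ) (q : ℕ → ℝ × ℝ) : ℝ :=
  ∑' t, flow ρ s G m q t

/-- The best value of a plan from the record `m` on. -/
noncomputable def optValue (ρ : ℝ) (s G : ℝ → ℝ) (m : ℝ) : ℝ :=
  sSup (planValue ρ s G m '' plans ρ)

/-- The value of offering the repayment amount `y` at the discount rate `d` when the record is `m`
and the continuation value is `W`. -/
def bellman (ρ : ℝ) (s G W : ℝ → ℝ) (m y d : ℝ) : ℝ :=
  s d * (y * (ρ * G (max m y) - d * G m) + ρ * W (max m y))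

/-- The pair `(y, d)` is the first step of an optimal plan from the record `m` on. -/
structure IsOptStep (ρ : ℝ) (s G : ℝ → ℝ) (m y d : ℝ) : Prop where
  repay_mem : y ∈ Set.Icc (0 : ℝ) 1
  disc_mem : d ∈ Set.Icc 0 ρ
  optValue_eq : optValue ρ s G m = bellman ρ s G (optValue ρ s G) m y d

variable {ρ : ℝ} {s G : ℝ → ℝ}

lemma flow_zero (m : ℝ) (q : ℕ → ℝ × ℝ) :
    flow ρ s G m q 0 = s (q 0).2 * ((q 0).1 * (ρ * G (max m (q 0).1) - (q 0).2 * G m)) := by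
  simp [flow, record]

lemma flow_succ (m : ℝ) (q : ℕ → ℝ × ℝ) (t : ℕ) :
    flow ρ s G m q (t + 1)
      = s (q 0).2 * ρ * flow ρ s G (max m (q 0).1) (fun i => q (i + 1)) t := by
  simp only [flow]
  rw [record_succ_eq_record_tail m _ (t + 1), record_succ_eq_record_tail m _ t,
    Finset.prod_range_succ']
  ring

lemma bellman_of_le {W : ℝ → ℝ} {m y : ℝ} (h : m ≤ y) (d : ℝ) :
    bellman ρ s G W m y d = s d * (ρ * (y * G y + W y) - d * (y * G m)) := by
  rw [bellman, max_eq_right h]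
  ring

lemma bellman_of_ge {W : ℝ → ℝ} {m y : ℝ} (h : y ≤ m) (d : ℝ) :
    bellman ρ s G W m y d = s d * ((ρ - d) * (y * G m) + ρ * W m) := by
  rw [bellman, max_eq_left h]
  ring

lemma tail_mem_plans {q : ℕ → ℝ × ℝ} (hq : q ∈ plans ρ) : (fun i => q (i + 1)) ∈ plans ρ :=
  fun i _ => hq (i + 1) trivial

lemma isCompact_plans (ρ : ℝ) : IsCompact (plans ρ) :=
  isCompact_univ_pi fun _ => isCompact_Icc.prod isCompact_Icc

lemma continuous_record (m : ℝ) (t : ℕ) :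
    Continuous fun q : ℕ → ℝ × ℝ => record m (fun i => (q i).1) t := by
  induction t with
  | zero => exact continuous_const
  | succ t ih => exact ih.max (by fun_prop)

namespace IsLendingMarket

lemma plans_nonempty (hs : IsLendingMarket ρ s) : (plans ρ).Nonempty :=
  ⟨fun _ => (0, 0), fun _ _ => ⟨⟨le_rfl, zero_le_one⟩, ⟨le_rfl, hs.rho_nonneg⟩⟩⟩

lemma abs_flow_le (hs : IsLendingMarket ρ s) (hG : IsSurvival G) (m : ℝ) {q : ℕ → ℝ × ℝ}
    (hq : q ∈ plans ρ) (t : ℕ) : |flow ρ s G m q t| ≤ ρ ^ t := by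
  have hrepay : ∀ i, (q i).1 ∈ Set.Icc (0 : ℝ) 1 := fun i => (hq i trivial).1
  have hdisc : ∀ i, (q i).2 ∈ Set.Icc 0 ρ := fun i => (hq i trivial).2
  have hdemand : |∏ i ∈ Finset.range (t + 1), s (q i).2| ≤ 1 := by
    rw [abs_of_nonneg (Finset.prod_nonneg fun i _ => (hs.mapsTo (hdisc i)).1)]
    exact Finset.prod_le_one (fun i _ => (hs.mapsTo (hdisc i)).1)
      fun i _ => (hs.mapsTo (hdisc i)).2
  have hdiscounted : ∀ {r : ℝ} (x : ℝ), r ∈ Set.Icc 0 ρ → r * G x ∈ Set.Icc 0 1 := fun x hr =>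
    ⟨mul_nonneg hr.1 (hG.nonneg x),
      mul_le_one₀ (hr.2.trans hs.rho_lt_one.le) (hG.nonneg x) (hG.le_one x)⟩
  have hprofit : |(q t).1 * (ρ * G (record m (fun i => (q i).1) (t + 1))
      - (q t).2 * G (record m (fun i => (q i).1) t))| ≤ 1 := by
    rw [abs_mul, abs_of_nonneg (hrepay t).1]
    refine mul_le_one₀ (hrepay t).2 (abs_nonneg _) ?_
    simpa using Set.abs_sub_le_of_uIcc_subset_uIcc (a := (0 : ℝ)) (b := 1)
      (Set.uIcc_subset_uIcc (Set.Icc_subset_uIcc (hdiscounted _ (hdisc t)))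
        (Set.Icc_subset_uIcc (hdiscounted _ ⟨hs.rho_nonneg, le_rfl⟩)))
  rw [flow, abs_mul, abs_mul, abs_of_nonneg (pow_nonneg hs.rho_nonneg t), mul_assoc]
  exact mul_le_of_le_one_right (pow_nonneg hs.rho_nonneg t)
    (mul_le_one₀ hdemand (abs_nonneg _) hprofit)

lemma summable_flow (hs : IsLendingMarket ρ s) (hG : IsSurvival G) (m : ℝ) {q : ℕ → ℝ × ℝ}
    (hq : q ∈ plans ρ) : Summable (flow ρ s G m q) :=
  Summable.of_norm_bounded (summable_geometric_of_lt_one hs.rho_nonneg hs.rho_lt_one)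
    fun t => hs.abs_flow_le hG m hq t

lemma planValue_eq_bellman (hs : IsLendingMarket ρ s) (hG : IsSurvival G) (m : ℝ)
    {q : ℕ → ℝ × ℝ} (hq : q ∈ plans ρ) :
    planValue ρ s G m q
      = bellman ρ s G (planValue ρ s G · fun i => q (i + 1)) m (q 0).1 (q 0).2 := by
  rw [planValue, (hs.summable_flow hG m hq).tsum_eq_zero_add, flow_zero]
  simp only [flow_succ]
  rw [tsum_mul_left, bellman, planValue]
  ring

lemma continuousOn_flow (hs : IsLendingMarket ρ s) (hG : IsSurvival G) (m : ℝ) (t : ℕ) :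
    ContinuousOn (fun q => flow ρ s G m q t) (plans ρ) := by
  have hdemand : ∀ i, ContinuousOn (fun q : ℕ → ℝ × ℝ => s (q i).2) (plans ρ) := fun i =>
    hs.continuousOn.comp (by fun_prop) fun q hq => (hq i trivial).2
  have hsurvival : ∀ i, Continuous fun q : ℕ → ℝ × ℝ => G (record m (fun i => (q i).1) i) :=
    fun i => hG.continuous.comp (continuous_record m i)
  have hprofit : Continuous fun q : ℕ → ℝ × ℝ =>
      (q t).1 * (ρ * G (record m (fun i => (q i).1) (t + 1))
        - (q t).2 * G (record m (fun i => (q i).1) t)) :=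
    .mul (by fun_prop) (((hsurvival (t + 1)).const_mul ρ).sub (.mul (by fun_prop) (hsurvival t)))
  exact (continuousOn_const.mul (continuousOn_finsetProd _ fun i _ => hdemand i)).mul
    hprofit.continuousOn

lemma isCompact_image_planValue (hs : IsLendingMarket ρ s) (hG : IsSurvival G) (m : ℝ) :
    IsCompact (planValue ρ s G m '' plans ρ) :=
  (isCompact_plans ρ).image_of_continuousOn <|
    continuousOn_tsum (hs.continuousOn_flow hG m)
      (summable_geometric_of_lt_one hs.rho_nonneg hs.rho_lt_one)
      fun t _ hq => hs.abs_flow_le hG m hq t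

lemma exists_planValue_eq_optValue (hs : IsLendingMarket ρ s) (hG : IsSurvival G) (m : ℝ) :
    ∃ q ∈ plans ρ, planValue ρ s G m q = optValue ρ s G m :=
  (hs.isCompact_image_planValue hG m).sSup_mem (hs.plans_nonempty.image _)

lemma planValue_le_optValue (hs : IsLendingMarket ρ s) (hG : IsSurvival G) (m : ℝ)
    {q : ℕ → ℝ × ℝ} (hq : q ∈ plans ρ) : planValue ρ s G m q ≤ optValue ρ s G m :=
  le_csSup (hs.isCompact_image_planValue hG m).bddAbove (Set.mem_image_of_mem _ hq)

lemma bellman_le_optValue (hs : IsLendingMarket ρ s) (hG : IsSurvival G) (m : ℝ) {y d : ℝ}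
    (hy : y ∈ Set.Icc (0 : ℝ) 1) (hd : d ∈ Set.Icc 0 ρ) :
    bellman ρ s G (optValue ρ s G) m y d ≤ optValue ρ s G m := by
  obtain ⟨q, hq, hq_opt⟩ := hs.exists_planValue_eq_optValue hG (max m y)
  let q' : ℕ → ℝ × ℝ := fun t => Nat.casesOn t (y, d) q
  have hq' : q' ∈ plans ρ := by
    rintro (_ | i) _
    · exact ⟨hy, hd⟩
    · exact hq i trivial
  have hle := hs.planValue_le_optValue hG m hq'
  rw [hs.planValue_eq_bellman hG m hq'] at hle
  rw [bellman, ← hq_opt]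
  exact hle

lemma exists_isOptStep (hs : IsLendingMarket ρ s) (hG : IsSurvival G) (m : ℝ) :
    ∃ y d, IsOptStep ρ s G m y d := by
  obtain ⟨q, hq, hq_opt⟩ := hs.exists_planValue_eq_optValue hG m
  obtain ⟨hy, hd⟩ := hq 0 trivial
  refine ⟨(q 0).1, (q 0).2, hy, hd, le_antisymm ?_ (hs.bellman_le_optValue hG m hy hd)⟩
  rw [← hq_opt, hs.planValue_eq_bellman hG m hq, bellman, bellman]
  have hle := hs.planValue_le_optValue hG (max m (q 0).1) (tail_mem_plans hq)
  have hdemand := (hs.mapsTo hd).1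
  have hρ := hs.rho_nonneg
  gcongr

lemma sum_flow_le_of_bellman_le (hs : IsLendingMarket ρ s) {W : ℝ → ℝ} {m₀ : ℝ}
    (hW : ∀ m, m₀ ≤ m → 0 ≤ W m)
    (hbellman : ∀ m, m₀ ≤ m → ∀ y ∈ Set.Icc (0 : ℝ) 1, ∀ d ∈ Set.Icc 0 ρ,
      bellman ρ s G W m y d ≤ W m) (n : ℕ) {m : ℝ} (hm : m₀ ≤ m) {q : ℕ → ℝ × ℝ}
    (hq : q ∈ plans ρ) : ∑ t ∈ Finset.range n, flow ρ s G m q t ≤ W m := by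
  induction n generalizing m q with
  | zero => simpa using hW m hm
  | succ n ih =>
    obtain ⟨hy, hd⟩ := hq 0 trivial
    rw [Finset.sum_range_succ', flow_zero]
    simp only [flow_succ]
    rw [← Finset.mul_sum]
    have htail := mul_le_mul_of_nonneg_left
      (ih (hm.trans (le_max_left m (q 0).1)) (tail_mem_plans hq))
      (mul_nonneg (hs.mapsTo hd).1 hs.rho_nonneg)
    have hstep := hbellman m hm _ hy _ hd
    rw [bellman] at hstep
    linarith

lemma optValue_le_of_bellman_le (hs : IsLendingMarket ρ s) (hG : IsSurvival G) {W : ℝ → ℝ}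
    {m₀ : ℝ} (hW : ∀ m, m₀ ≤ m → 0 ≤ W m)
    (hbellman : ∀ m, m₀ ≤ m → ∀ y ∈ Set.Icc (0 : ℝ) 1, ∀ d ∈ Set.Icc 0 ρ,
      bellman ρ s G W m y d ≤ W m) {m : ℝ} (hm : m₀ ≤ m) : optValue ρ s G m ≤ W m := by
  obtain ⟨q, hq, hq_opt⟩ := hs.exists_planValue_eq_optValue hG m
  rw [← hq_opt]
  exact le_of_tendsto' (hs.summable_flow hG m hq).hasSum.tendsto_sum_nat
    fun n => hs.sum_flow_le_of_bellman_le hW hbellman n hm hq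

lemma mul_sub_le_of_isOptStep (hs : IsLendingMarket ρ s) (hG : IsSurvival G)
    {m v y y' d d' : ℝ} (hv : v ∈ Set.Icc (0 : ℝ) 1) (hmv : m ≤ v) (hvy : v ≤ y) (hyy' : y ≤ y')
    (hd : 0 < s d) (hstep : IsOptStep ρ s G m y d) (hstep' : IsOptStep ρ s G y y' d') :
    ρ * ((v - s d' * d' * y') * G v) - d * (v * G m)
      ≤ ρ * ((y - s d' * d' * y') * G y) - d * (y * G m) := by
  have hdev := hs.bellman_le_optValue hG m hv hstep.disc_mem
  rw [hstep.optValue_eq, bellman_of_le hmv, bellman_of_le (hmv.trans hvy)] at hdev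
  have hdev := le_of_mul_le_mul_left hdev hd
  have hnext := hs.bellman_le_optValue hG v hstep'.repay_mem hstep'.disc_mem
  rw [bellman_of_le (hvy.trans hyy')] at hnext
  have hnext := mul_le_mul_of_nonneg_left hnext hs.rho_nonneg
  rw [hstep'.optValue_eq, bellman_of_le hyy'] at hdev
  linarith

/-- Offering `s d' * d' * y'` instead of `y` in the first step, or nothing new if the record is
larger, would reduce the loss. -/
lemma le_mul_of_isOptStep_of_loss (hs : IsLendingMarket ρ s) (hG : IsSurvival G)
    {m y y' d d' : ℝ} (hm : 0 ≤ m) (hmy : m ≤ y) (hyy' : y ≤ y') (hd : 0 < s d)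
    (hstep : IsOptStep ρ s G m y d) (hstep' : IsOptStep ρ s G y y' d')
    (hloss : ρ * G y < d * G m) : y ≤ s d' * d' * y' := by
  by_contra! hlt
  have hloss := mul_lt_mul_of_pos_left hloss (sub_pos.2 hlt)
  rcases le_total m (s d' * d' * y') with hm' | hm'
  · have hdev := hs.mul_sub_le_of_isOptStep hG
      ⟨hm.trans hm', hlt.le.trans hstep.repay_mem.2⟩ hm' hlt.le hyy' hd hstep hstep'
    linarith
  · have hdev := hs.mul_sub_le_of_isOptStep hG ⟨hm, hmy.trans hstep.repay_mem.2⟩ le_rfl hmy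
      hyy' hd hstep hstep'
    have hgain := mul_nonneg (sub_nonneg.2 hstep.disc_mem.2)
      (mul_nonneg (sub_nonneg.2 hm') (hG.nonneg m))
    linarith

end IsLendingMarket

/-- Nonnegative combinations of evaluations at points of `(0, m)`, as functionals of the survival
function: the losses from loans that screen out incomes below `m`. -/
noncomputable def screeningLosses (m : ℝ) : PointedCone ℝ (Module.Dual ℝ (ℝ → ℝ)) :=
  PointedCone.hull ℝ (LinearMap.proj '' Set.Ioo 0 m)

lemma proj_mem_screeningLosses {m y : ℝ} (hy : y ∈ Set.Ioo 0 m) :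
    (LinearMap.proj y : Module.Dual ℝ (ℝ → ℝ)) ∈ screeningLosses m :=
  Submodule.subset_span (Set.mem_image_of_mem _ hy)

lemma apply_le_apply_of_mem_screeningLosses {m : ℝ} {C : Module.Dual ℝ (ℝ → ℝ)}
    (hC : C ∈ screeningLosses m) {f g : ℝ → ℝ} (hfg : ∀ y ∈ Set.Ioo 0 m, f y ≤ g y) :
    C f ≤ C g := by
  induction hC using Submodule.span_induction with
  | mem C hC =>
    obtain ⟨y, hy, rfl⟩ := hC
    exact hfg y hy
  | zero => rfl
  | add C D _ _ hC hD => exact add_le_add hC hD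
  | smul c C _ hC => exact mul_le_mul_of_nonneg_left hC c.2

lemma continuousAt_apply_of_mem_screeningLosses {X : Type*} [TopologicalSpace X] {m : ℝ}
    {C : Module.Dual ℝ (ℝ → ℝ)} (hC : C ∈ screeningLosses m) {F : X → ℝ → ℝ} {x : X}
    (hF : ∀ y, ContinuousAt (fun x => F x y) x) : ContinuousAt (fun x => C (F x)) x := by
  induction hC using Submodule.span_induction with
  | mem C hC =>
    obtain ⟨y, -, rfl⟩ := hC
    exact hF y
  | zero => exact continuousAt_const
  | add C D _ _ hC hD => exact hC.add hD
  | smul c C _ hC => exact hC.const_mul (c : ℝ)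

/-- An optimal plan from the record `m` on that starts with the step `(y, d)`, makes screening loans
with repayment amounts below `m₁`, and then offers the repayment amount `z` for ever. Here `P` and
`C` are the coefficients at `z` and at the screening loans, of the value as a functional of the
survival function. The plan is feasible for all other survival functions. -/
structure IsScreeningPlan (ρ : ℝ) (s G : ℝ → ℝ) (z m₁ m y d : ℝ) (C : Module.Dual ℝ (ℝ → ℝ))
    (P : ℝ) : Prop where
  isOptStep : IsOptStep ρ s G m y d
  gain_pos : 0 < P
  loss_mem : C ∈ screeningLosses m₁
  value_eq : optValue ρ s G m = P * G z - C G - s d * d * y * G m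
  le_value : ∀ G', IsSurvival G' → ∀ v ∈ Set.Icc 0 m,
    P * G' z - C G' - s d * d * y * G' v ≤ optValue ρ s G' v

lemma IsScreeningPlan.cons {z m₁ m y y' d d' P : ℝ} {C : Module.Dual ℝ (ℝ → ℝ)}
    (hplan : IsScreeningPlan ρ s G z m₁ y y' d' C P) (hs : IsLendingMarket ρ s) (hρ : 0 < ρ)
    (hstep : IsOptStep ρ s G m y d) (hd : 0 < s d) (hmy : m ≤ y) (hy : y ∈ Set.Ioo 0 m₁)
    (hgrowth : y ≤ s d' * d' * y') :
    IsScreeningPlan ρ s G z m₁ m y d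
      ((ρ * s d) • (C + (s d' * d' * y' - y) • LinearMap.proj y)) (ρ * s d * P) where
  isOptStep := hstep
  gain_pos := mul_pos (mul_pos hρ hd) hplan.gain_pos
  loss_mem := (screeningLosses m₁).smul_mem (mul_pos hρ hd).le <|
    (screeningLosses m₁).add_mem hplan.loss_mem <|
      (screeningLosses m₁).smul_mem (sub_nonneg.2 hgrowth) (proj_mem_screeningLosses hy)
  value_eq := by
    rw [hstep.optValue_eq, bellman_of_le hmy, hplan.value_eq]
    simp only [LinearMap.smul_apply, LinearMap.add_apply, LinearMap.proj_apply, smul_eq_mul]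
    ring
  le_value G' hG' v hv := by
    refine le_trans ?_ (hs.bellman_le_optValue hG' v hstep.repay_mem hstep.disc_mem)
    have hcont := mul_le_mul_of_nonneg_left
      (hplan.le_value G' hG' y ⟨hy.1.le, le_rfl⟩) (mul_pos hρ hd).le
    rw [bellman_of_le (hv.2.trans hmy)]
    simp only [LinearMap.smul_apply, LinearMap.add_apply, LinearMap.proj_apply, smul_eq_mul]
    linarith

end DynamicProgramming

/-! ### Constant demand elasticity -/

section Pricing

variable {α : ℝ}

lemma young_rpow_lt {d u : ℝ} (hα : 0 < α) (hd : 0 ≤ d) (hu : 0 ≤ u) (hne : d ≠ u) :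
    (1 + α) * d ^ α * u < α * d ^ (1 + α) + u ^ (1 + α) := by
  rcases hd.eq_or_lt with rfl | hd
  · rw [Real.zero_rpow hα.ne', Real.zero_rpow (by positivity)]
    have := Real.rpow_pos_of_pos (hu.lt_of_ne hne) (1 + α)
    linarith
  · have hne' : u / d - 1 ≠ 0 := fun h =>
      hne ((div_eq_one_iff_eq hd.ne').1 (sub_eq_zero.1 h)).symm
    have hbernoulli := one_add_mul_self_lt_rpow_one_add
      (by linarith [div_nonneg hu hd.le]) hne' (p := 1 + α) (by linarith)
    rw [add_sub_cancel, Real.div_rpow hu hd.le, lt_div_iff₀ (Real.rpow_pos_of_pos hd _),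
      Real.rpow_one_add' hd.le (by positivity)] at hbernoulli
    rw [Real.rpow_one_add' hd.le (by positivity)]
    field_simp at hbernoulli
    linarith

lemma young_rpow_le {d u : ℝ} (hα : 0 < α) (hd : 0 ≤ d) (hu : 0 ≤ u) :
    (1 + α) * d ^ α * u ≤ α * d ^ (1 + α) + u ^ (1 + α) := by
  rcases eq_or_ne d u with rfl | h
  · rw [Real.rpow_one_add' hd (by positivity)]
    exact le_of_eq (by ring)
  · exact (young_rpow_lt hα hd hu h).le

lemma rpow_mul_sub_lt_rpow_mul_sub {d d' A B : ℝ} (hα : 0 < α) (hd : 0 ≤ d) (hdd' : d < d')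
    (hB : 0 < B) (hA : (1 + α) * d' * B ≤ α * A) :
    d ^ α * (A - d * B) < d' ^ α * (A - d' * B) := by
  have hd' : 0 ≤ d' := hd.trans hdd'.le
  have hyoung := young_rpow_lt hα hd hd' hdd'.ne
  rw [Real.rpow_one_add' hd (by positivity), Real.rpow_one_add' hd' (by positivity)] at hyoung
  have hyoung := mul_lt_mul_of_pos_left hyoung hB
  have hmargin := mul_le_mul_of_nonneg_left hA
    (sub_nonneg.2 (Real.rpow_le_rpow hd hdd'.le hα.le))
  refine lt_of_mul_lt_mul_left ?_ hα.le
  linarith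

/-- The stationary problem of a consumer who is known to repay: `δ` is the optimal discount rate
and `K` the value per unit of repayment, so that `K = δ ^ α * (ρ * (1 + K) - δ)` is the maximum of
`d ^ α * (ρ * (1 + K) - d)` over `d`. -/
structure StationaryLoan (ρ α δ K : ℝ) : Prop where
  rho_lt_one : ρ < 1
  alpha_pos : 0 < α
  disc_pos : 0 < δ
  disc_lt : δ < ρ
  mul_value : α * K = δ ^ (1 + α)
  firstOrder : α * (ρ * (1 + K)) = (1 + α) * δ

lemma exists_stationaryLoan {ρ : ℝ} (hρ : ρ ∈ Set.Ioo (0 : ℝ) 1) (hα : 0 < α) :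
    ∃ δ K, StationaryLoan ρ α δ K := by
  have hcont : ContinuousOn (fun δ : ℝ => (1 + α) * δ - ρ * (α + δ ^ (1 + α))) (Set.Icc 0 ρ) := by
    have : Continuous fun δ : ℝ => δ ^ (1 + α) := Real.continuous_rpow_const (by positivity)
    fun_prop
  have hlt : ρ ^ (1 + α) < 1 := Real.rpow_lt_one hρ.1.le hρ.2 (by positivity)
  obtain ⟨δ, hδ, hzero⟩ : ∃ δ ∈ Set.Ioo 0 ρ, (1 + α) * δ - ρ * (α + δ ^ (1 + α)) = 0 := by
    refine intermediate_value_Ioo hρ.1.le hcont ⟨?_, ?_⟩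
    · rw [Real.zero_rpow (by positivity)]
      linarith [mul_pos hρ.1 hα]
    · linarith [mul_lt_mul_of_pos_left hlt hρ.1]
  refine ⟨δ, δ ^ (1 + α) / α, hρ.2, hα, hδ.1, hδ.2, by field_simp, ?_⟩
  field_simp
  linarith

namespace StationaryLoan

variable {ρ δ K : ℝ}

lemma disc_lt_one (h : StationaryLoan ρ α δ K) : δ < 1 := h.disc_lt.trans h.rho_lt_one

lemma rho_pos (h : StationaryLoan ρ α δ K) : 0 < ρ := h.disc_pos.trans h.disc_lt

lemma value_pos (h : StationaryLoan ρ α δ K) : 0 < K := by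
  have := Real.rpow_pos_of_pos h.disc_pos (1 + α)
  rw [← h.mul_value] at this
  exact pos_of_mul_pos_right this h.alpha_pos.le

lemma isLendingMarket (h : StationaryLoan ρ α δ K) :
    IsLendingMarket ρ (constElasticityDemand α) where
  rho_nonneg := h.rho_pos.le
  rho_lt_one := h.rho_lt_one
  continuousOn := (Real.continuous_rpow_const h.alpha_pos.le).continuousOn
  mapsTo _ hd := ⟨Real.rpow_nonneg hd.1 _,
    Real.rpow_le_one hd.1 (hd.2.trans h.rho_lt_one.le) h.alpha_pos.le⟩

lemma value_mul_rpow (h : StationaryLoan ρ α δ K) {x B : ℝ} (hx : 0 ≤ x) (hB : 0 < B) :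
    α * (K * B ^ (-α) * x ^ (1 + α)) = B * (δ * (x / B)) ^ (1 + α) := by
  rw [Real.mul_rpow h.disc_pos.le (by positivity), ← h.mul_value, Real.div_rpow hx hB.le,
    Real.rpow_one_add' hB.le (by linarith [h.alpha_pos]), Real.rpow_neg hB.le]
  field_simp

lemma profit_eq (h : StationaryLoan ρ α δ K) {x B : ℝ} (hx : 0 ≤ x) (hB : 0 < B) :
    (δ * (x / B)) ^ α * (ρ * ((1 + K) * x) - δ * (x / B) * B) = K * B ^ (-α) * x ^ (1 + α) := by
  have he : 0 ≤ δ * (x / B) := mul_nonneg h.disc_pos.le (by positivity)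
  refine mul_left_cancel₀ h.alpha_pos.ne' ?_
  rw [h.value_mul_rpow hx hB, Real.rpow_one_add' he (by linarith [h.alpha_pos])]
  have hBx : δ * (x / B) * B = δ * x := by field_simp
  linear_combination (δ * (x / B)) ^ α * (x * h.firstOrder - (1 + α) * hBx)

lemma profit_le (h : StationaryLoan ρ α δ K) {x B d : ℝ} (hx : 0 ≤ x) (hB : 0 < B)
    (hd : 0 ≤ d) : d ^ α * (ρ * ((1 + K) * x) - d * B) ≤ K * B ^ (-α) * x ^ (1 + α) := by
  have he : 0 ≤ δ * (x / B) := mul_nonneg h.disc_pos.le (by positivity)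
  have hα := h.alpha_pos
  have hyoung := mul_le_mul_of_nonneg_left (young_rpow_le hα hd he) hB.le
  refine le_of_mul_le_mul_left ?_ hα
  rw [h.value_mul_rpow hx hB]
  calc α * (d ^ α * (ρ * ((1 + K) * x) - d * B))
      = B * ((1 + α) * d ^ α * (δ * (x / B))) - B * (α * d ^ (1 + α)) := by
        rw [Real.rpow_one_add' hd (by positivity)]
        have hBx : δ * (x / B) * B = δ * x := by field_simp
        linear_combination d ^ α * (x * h.firstOrder - (1 + α) * hBx)
    _ ≤ _ := by linarith

lemma value_eq (h : StationaryLoan ρ α δ K) : K = δ ^ α * (ρ * (1 + K) - δ) := by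
  simpa using (h.profit_eq zero_le_one one_pos).symm

lemma profit_le_value (h : StationaryLoan ρ α δ K) {d : ℝ} (hd : 0 ≤ d) :
    d ^ α * (ρ * (1 + K) - d) ≤ K := by
  simpa using h.profit_le zero_le_one one_pos hd

lemma rpow_add_value_le (h : StationaryLoan ρ α δ K) {r : ℝ} (hr : δ ≤ r) (hr1 : r ≤ 1) :
    r ^ (1 + α) + K ≤ r ^ α * (1 + K) := by
  have hα := h.alpha_pos
  have hr0 : 0 < r := h.disc_pos.trans_le hr
  have hrα : r ^ α ≤ 1 := Real.rpow_le_one hr0.le hr1 hα.le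
  have hK : α * K ≤ r ^ (1 + α) := h.mul_value.trans_le
    (Real.rpow_le_rpow h.disc_pos.le hr (by positivity))
  have hK := mul_le_mul_of_nonneg_right hK (sub_nonneg.2 hrα)
  have hyoung := young_rpow_le hα zero_le_one hr0.le
  rw [Real.one_rpow, Real.one_rpow] at hyoung
  have hyoung := mul_le_mul_of_nonneg_left hyoung (Real.rpow_nonneg hr0.le α)
  have hpow : r ^ (1 + α) = r * r ^ α := Real.rpow_one_add' hr0.le (by positivity)
  refine le_of_mul_le_mul_left ?_ hα
  rw [hpow] at hK hyoung ⊢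
  linarith

/-- The ratio `r` measures how much worse the repayment amount `y` is than the best one. -/
lemma mul_add_value_mul_le (h : StationaryLoan ρ α δ K) {y g H r : ℝ} (hg : 0 < g) (hH : 0 ≤ H)
    (hr : δ ≤ r) (hr1 : r ≤ 1) (hyg : y * g ^ (1 + α) = H * r ^ (1 + α)) :
    y * g + K * g ^ (-α) * H ≤ (1 + K) * (y * g / r) := by
  have hα := h.alpha_pos
  have hr0 : 0 < r := h.disc_pos.trans_le hr
  have := Real.rpow_pos_of_pos hg α
  have hyg' : y * g = H * r ^ (1 + α) * g ^ (-α) := by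
    rw [← hyg, Real.rpow_neg hg.le, Real.rpow_one_add' hg.le (by positivity)]
    field_simp
  calc y * g + K * g ^ (-α) * H = H * g ^ (-α) * (r ^ (1 + α) + K) := by rw [hyg']; ring
    _ ≤ H * g ^ (-α) * (r ^ α * (1 + K)) :=
        mul_le_mul_of_nonneg_left (h.rpow_add_value_le hr hr1)
          (mul_nonneg hH (Real.rpow_nonneg hg.le _))
    _ = (1 + K) * (y * g / r) := by
        rw [hyg', Real.rpow_one_add' hr0.le (by positivity)]
        field_simp

lemma step_le_of_ratio (h : StationaryLoan ρ α δ K) {y d w g M H r : ℝ} (hy : 0 < y) (hg : 0 < g)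
    (hM : 0 < M) (hH : 0 ≤ H) (hd : 0 ≤ d) (hw : w ≤ K * g ^ (-α) * H) (hr : δ ≤ r)
    (hr1 : r ≤ 1) (hyg : y * g ^ (1 + α) = H * r ^ (1 + α)) :
    d ^ α * (ρ * (y * g + w) - d * (y * M)) ≤ K * M ^ (-α) * H := by
  have hα := h.alpha_pos
  have hr0 : 0 < r := h.disc_pos.trans_le hr
  have hvalue : y * g + w ≤ (1 + K) * (y * g / r) :=
    (by linarith : y * g + w ≤ y * g + K * g ^ (-α) * H).trans
      (h.mul_add_value_mul_le hg hH hr hr1 hyg)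
  calc d ^ α * (ρ * (y * g + w) - d * (y * M))
      ≤ d ^ α * (ρ * ((1 + K) * (y * g / r)) - d * (y * M)) := by
        have := h.rho_pos.le
        gcongr
    _ ≤ K * (y * M) ^ (-α) * (y * g / r) ^ (1 + α) :=
        h.profit_le (by positivity) (by positivity) hd
    _ = K * M ^ (-α) * (y * g ^ (1 + α) / r ^ (1 + α)) := by
        rw [Real.div_rpow (by positivity) hr0.le, Real.mul_rpow hy.le hg.le,
          Real.mul_rpow hy.le hM.le, Real.rpow_neg hy.le, Real.rpow_one_add' hy.le (by positivity)]
        have := Real.rpow_pos_of_pos hy α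
        field_simp
    _ = K * M ^ (-α) * H := by
        have := Real.rpow_pos_of_pos hr0 (1 + α)
        rw [hyg]
        field_simp

/-- With `g` and `M` the probabilities of repayment and of the record, `K * g ^ (-α) * H` and
`K * M ^ (-α) * H` are the values of jumping to a repayment amount whose static profit is `H`. -/
lemma step_le (h : StationaryLoan ρ α δ K) {y d w g M H : ℝ} (hy : 0 ≤ y) (hg : 0 ≤ g)
    (hM : 0 < M) (hd : 0 ≤ d) (hw : w ≤ K * g ^ (-α) * H)
    (hlow : δ ^ (1 + α) * H ≤ y * g ^ (1 + α)) (hup : y * g ^ (1 + α) ≤ H) :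
    d ^ α * (ρ * (y * g + w) - d * (y * M)) ≤ K * M ^ (-α) * H := by
  have hα := h.alpha_pos
  have hα1 : 0 < 1 + α := by positivity
  have hH : 0 ≤ H := (mul_nonneg hy (Real.rpow_nonneg hg _)).trans hup
  rcases hH.eq_or_lt with rfl | hH
  · have hyg : y * g = 0 := by
      have := le_antisymm hup (by simpa using hlow)
      simpa [Real.rpow_eq_zero_iff_of_nonneg hg, hα1.ne'] using this
    rw [mul_zero] at hw
    rw [mul_zero, hyg, zero_add]
    refine mul_nonpos_of_nonneg_of_nonpos (Real.rpow_nonneg hd _) ?_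
    linarith [mul_nonpos_of_nonneg_of_nonpos h.rho_pos.le hw, mul_nonneg hd (mul_nonneg hy hM.le)]
  · have hpos : 0 < y * g ^ (1 + α) :=
      (mul_pos (Real.rpow_pos_of_pos h.disc_pos _) hH).trans_le hlow
    have hy' : 0 < y := hy.lt_of_ne' (left_ne_zero_of_mul hpos.ne')
    have hg' : 0 < g := hg.lt_of_ne' fun h0 => by simp [h0, hα1.ne'] at hpos
    have hratio := (div_pos hpos hH).le
    refine h.step_le_of_ratio hy' hg' hM hH.le hd hw
      (r := (y * g ^ (1 + α) / H) ^ (1 + α)⁻¹) ?_ ?_ ?_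
    · rwa [Real.le_rpow_inv_iff_of_pos h.disc_pos.le hratio hα1, le_div_iff₀ hH]
    · exact Real.rpow_le_one hratio ((div_le_one hH).2 hup) (inv_nonneg.2 hα1.le)
    · rw [Real.rpow_inv_rpow hratio hα1.ne']
      field_simp

end StationaryLoan

end Pricing

section OptimalPlan

variable {ρ α δ K : ℝ} {G : ℝ → ℝ} {z : ℝ}

/-- The profit from jumping to the repayment amount `y` and staying there, up to a factor that
depends only on the current record. -/
noncomputable def jumpProfit (α : ℝ) (G : ℝ → ℝ) (y : ℝ) : ℝ := y * G y ^ (1 + α)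

/-- A survival function for which the profit from a jump is unimodal with mode `z`. -/
structure HasPeak (α : ℝ) (G : ℝ → ℝ) (z : ℝ) : Prop extends IsSurvival G where
  strictAntiOn : StrictAntiOn G (Set.Icc 0 1)
  peak_mem : z ∈ Set.Ioo (0 : ℝ) 1
  strictMonoOn_jumpProfit : StrictMonoOn (jumpProfit α G) (Set.Icc 0 z)
  strictAntiOn_jumpProfit : StrictAntiOn (jumpProfit α G) (Set.Icc z 1)

lemma IsSurvival.jumpProfit_nonneg (hG : IsSurvival G) {y : ℝ} (hy : 0 ≤ y) :
    0 ≤ jumpProfit α G y :=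
  mul_nonneg hy (Real.rpow_nonneg (hG.nonneg y) _)

lemma IsSurvival.continuous_jumpProfit (hG : IsSurvival G) (hα : 0 < α) :
    Continuous (jumpProfit α G) :=
  continuous_id.mul (hG.continuous.rpow_const fun _ => Or.inr (by positivity))

namespace HasPeak

lemma pos (h : HasPeak α G z) {y : ℝ} (hy : y < 1) : 0 < G y := by
  rcases le_total y 0 with hy0 | hy0
  · rw [h.eq_one y hy0]
    exact one_pos
  · rw [← h.eq_zero 1 le_rfl]
    exact h.strictAntiOn ⟨hy0, hy.le⟩ ⟨zero_le_one, le_rfl⟩ hy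

lemma peak_mem_Icc (h : HasPeak α G z) : z ∈ Set.Icc (0 : ℝ) 1 := Set.Ioo_subset_Icc_self h.peak_mem

lemma jumpProfit_peak_pos (h : HasPeak α G z) : 0 < jumpProfit α G z :=
  mul_pos h.peak_mem.1 (Real.rpow_pos_of_pos (h.pos h.peak_mem.2) _)

lemma jumpProfit_le_max (h : HasPeak α G z) {y : ℝ} (hy : y ∈ Set.Icc (0 : ℝ) 1) :
    jumpProfit α G y ≤ jumpProfit α G (max y z) := by
  rcases le_total y z with hyz | hyz
  · rw [max_eq_right hyz]
    exact h.strictMonoOn_jumpProfit.monotoneOn ⟨hy.1, hyz⟩ ⟨h.peak_mem.1.le, le_rfl⟩ hyz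
  · rw [max_eq_left hyz]

lemma jumpProfit_max_le_jumpProfit_max (h : HasPeak α G z) {m y : ℝ} (hmy : m ≤ y) (hy : y ≤ 1) :
    jumpProfit α G (max y z) ≤ jumpProfit α G (max m z) :=
  h.strictAntiOn_jumpProfit.antitoneOn ⟨le_max_right _ _, max_le (hmy.trans hy) h.peak_mem.2.le⟩
    ⟨le_max_right _ _, max_le hy h.peak_mem.2.le⟩ (max_le_max_right z hmy)

end HasPeak

/-- The repayment amount below the mode `z` at which the profit from a jump is the fraction
`δ ^ (1 + α)` of its maximum. From this record on, an immediate jump to the mode is optimal. -/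
structure IsThreshold (α δ : ℝ) (G : ℝ → ℝ) (z m₁ : ℝ) : Prop where
  pos : 0 < m₁
  lt_peak : m₁ < z
  jumpProfit_eq : jumpProfit α G m₁ = δ ^ (1 + α) * jumpProfit α G z

namespace StationaryLoan

lemma exists_isThreshold (hS : StationaryLoan ρ α δ K) (h : HasPeak α G z) :
    ∃ m₁, IsThreshold α δ G z m₁ := by
  have hα := hS.alpha_pos
  have hδ1 : δ ^ (1 + α) < 1 := Real.rpow_lt_one hS.disc_pos.le hS.disc_lt_one (by positivity)
  have hδ0 : 0 < δ ^ (1 + α) := Real.rpow_pos_of_pos hS.disc_pos _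
  obtain ⟨m₁, hm₁, heq⟩ := intermediate_value_Ioo h.peak_mem.1.le
    (h.continuous_jumpProfit hα).continuousOn
    (show δ ^ (1 + α) * jumpProfit α G z ∈ Set.Ioo (jumpProfit α G 0) (jumpProfit α G z) from
      ⟨by simpa [jumpProfit] using mul_pos hδ0 h.jumpProfit_peak_pos,
        mul_lt_of_lt_one_left h.jumpProfit_peak_pos hδ1⟩)
  exact ⟨m₁, hm₁.1, hm₁.2, heq⟩

lemma mul_le_optValue (hS : StationaryLoan ρ α δ K) (hG : IsSurvival G) {y : ℝ}
    (hy : y ∈ Set.Icc (0 : ℝ) 1) :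
    K * (y * G y) ≤ optValue ρ (constElasticityDemand α) G y := by
  have hstay := hS.isLendingMarket.bellman_le_optValue hG y hy ⟨hS.disc_pos.le, hS.disc_lt.le⟩
  rw [bellman_of_le le_rfl, constElasticityDemand] at hstay
  have hδ : δ ^ α < 1 := Real.rpow_lt_one hS.disc_pos.le hS.disc_lt_one hS.alpha_pos
  have hρδ : ρ * δ ^ α < 1 := mul_lt_one_of_nonneg_of_lt_one_left hS.rho_pos.le hS.rho_lt_one hδ.le
  refine le_of_mul_le_mul_right ?_ (sub_pos.2 hρδ)
  linear_combination hstay + y * G y * hS.value_eq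

lemma jump_disc_mem (hS : StationaryLoan ρ α δ K) (hG : IsSurvival G) {m y : ℝ} (hmy : m ≤ y)
    (hGm : 0 < G m) : δ * (G y / G m) ∈ Set.Icc 0 ρ := by
  have hle : G y / G m ≤ 1 := (div_le_one hGm).2 (hG.antitone hmy)
  exact ⟨mul_nonneg hS.disc_pos.le (div_nonneg (hG.nonneg y) hGm.le),
    (mul_le_of_le_one_right hS.disc_pos.le hle).trans hS.disc_lt.le⟩

lemma jump_le_bellman (hS : StationaryLoan ρ α δ K) (hG : IsSurvival G) {m y : ℝ} (hy0 : 0 < y)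
    (hmy : m ≤ y) (hy : y ≤ 1) (hGm : 0 < G m) :
    K * G m ^ (-α) * jumpProfit α G y ≤ bellman ρ (constElasticityDemand α) G
      (optValue ρ (constElasticityDemand α) G) m y (δ * (G y / G m)) := by
  have hα := hS.alpha_pos
  have hGy := hG.nonneg y
  have hx : 0 ≤ y * G y := mul_nonneg hy0.le hGy
  have hprofit := hS.profit_eq hx (mul_pos hy0 hGm)
  rw [mul_div_mul_left _ _ hy0.ne', Real.mul_rpow hy0.le hGm.le, Real.mul_rpow hy0.le hGy,
    Real.rpow_neg hy0.le, Real.rpow_one_add' hy0.le (by positivity)] at hprofit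
  calc K * G m ^ (-α) * jumpProfit α G y
      = K * ((y ^ α)⁻¹ * G m ^ (-α)) * (y * y ^ α * G y ^ (1 + α)) := by
        have := Real.rpow_pos_of_pos hy0 α
        rw [jumpProfit]
        field_simp
    _ = _ := hprofit.symm
    _ ≤ _ := by
        rw [bellman_of_le hmy, constElasticityDemand]
        refine mul_le_mul_of_nonneg_left ?_
          (Real.rpow_nonneg (hS.jump_disc_mem hG hmy hGm).1 _)
        linarith [mul_le_mul_of_nonneg_left (hS.mul_le_optValue hG ⟨hy0.le, hy⟩) hS.rho_pos.le]

lemma jump_le_optValue (hS : StationaryLoan ρ α δ K) (hG : IsSurvival G) {m y : ℝ} (hy0 : 0 < y)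
    (hmy : m ≤ y) (hy : y ≤ 1) (hGm : 0 < G m) :
    K * G m ^ (-α) * jumpProfit α G y ≤ optValue ρ (constElasticityDemand α) G m :=
  (hS.jump_le_bellman hG hy0 hmy hy hGm).trans
    (hS.isLendingMarket.bellman_le_optValue hG m ⟨hy0.le, hy⟩ (hS.jump_disc_mem hG hmy hGm))

lemma step_le_of_threshold_le (hS : StationaryLoan ρ α δ K) (h : HasPeak α G z) {m₁ : ℝ}
    (hm₁ : IsThreshold α δ G z m₁) {m y d w : ℝ} (hm : m < 1) (hy : m₁ ≤ y) (hy1 : y ≤ 1)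
    (hd : 0 ≤ d) (hw : w ≤ K * G y ^ (-α) * jumpProfit α G (max y z)) :
    d ^ α * (ρ * (y * G y + w) - d * (y * G m)) ≤ K * G m ^ (-α) * jumpProfit α G (max y z) := by
  have hα := hS.alpha_pos
  have hy0 : 0 ≤ y := hm₁.pos.le.trans hy
  refine hS.step_le hy0 (h.nonneg y) (h.pos hm) hd hw ?_ (h.jumpProfit_le_max ⟨hy0, hy1⟩)
  rcases le_total y z with hyz | hyz
  · rw [max_eq_right hyz, ← hm₁.jumpProfit_eq]
    exact h.strictMonoOn_jumpProfit.monotoneOn ⟨hm₁.pos.le, hm₁.lt_peak.le⟩ ⟨hy0, hyz⟩ hy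
  · rw [max_eq_left hyz]
    exact mul_le_of_le_one_left (h.jumpProfit_nonneg hy0)
      (Real.rpow_le_one hS.disc_pos.le hS.disc_lt_one.le (by positivity))

lemma bellman_le_of_threshold_le (hS : StationaryLoan ρ α δ K) (h : HasPeak α G z) {m₁ : ℝ}
    (hm₁ : IsThreshold α δ G z m₁) {m y d : ℝ} (hm : m₁ ≤ m) (hy : y ≤ 1) (hd : d ∈ Set.Icc 0 ρ) :
    bellman ρ (constElasticityDemand α) G (fun m => K * G m ^ (-α) * jumpProfit α G (max m z)) m y d
      ≤ K * G m ^ (-α) * jumpProfit α G (max m z) := by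
  have hα := hS.alpha_pos
  rcases le_or_gt 1 m with hm1 | hm1
  · have hGm : G m = 0 := h.eq_zero m hm1
    have hGmy : G (max m y) = 0 := h.eq_zero _ (hm1.trans (le_max_left _ _))
    simp [bellman, hGm, hGmy, Real.zero_rpow (neg_ne_zero.2 hα.ne')]
  rcases le_total y m with hym | hym
  · refine le_trans ?_ (hS.step_le_of_threshold_le h hm₁ hm1 hm hm1.le hd.1 le_rfl)
    rw [bellman_of_ge hym, constElasticityDemand]
    refine mul_le_mul_of_nonneg_left ?_ (Real.rpow_nonneg hd.1 _)
    linarith [mul_le_mul_of_nonneg_right hym (mul_nonneg (sub_nonneg.2 hd.2) (h.nonneg m))]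
  · rw [bellman_of_le hym]
    exact (hS.step_le_of_threshold_le h hm₁ hm1 (hm.trans hym) hy hd.1 le_rfl).trans
      (mul_le_mul_of_nonneg_left (h.jumpProfit_max_le_jumpProfit_max hym hy)
        (mul_nonneg hS.value_pos.le (Real.rpow_nonneg (h.nonneg m) _)))

lemma optValue_le_of_threshold_le (hS : StationaryLoan ρ α δ K) (h : HasPeak α G z) {m₁ : ℝ}
    (hm₁ : IsThreshold α δ G z m₁) {m : ℝ} (hm : m₁ ≤ m) :
    optValue ρ (constElasticityDemand α) G m ≤ K * G m ^ (-α) * jumpProfit α G (max m z) :=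
  hS.isLendingMarket.optValue_le_of_bellman_le h.toIsSurvival
    (W := fun m => K * G m ^ (-α) * jumpProfit α G (max m z))
    (fun m _ => mul_nonneg (mul_nonneg hS.value_pos.le (Real.rpow_nonneg (h.nonneg m) _))
      (h.jumpProfit_nonneg (h.peak_mem.1.le.trans (le_max_right _ _))))
    (fun _ hm _ hy _ hd => hS.bellman_le_of_threshold_le h hm₁ hm hy.2 hd) hm

lemma optValue_peak (hS : StationaryLoan ρ α δ K) (h : HasPeak α G z) :
    optValue ρ (constElasticityDemand α) G z = K * (z * G z) := by
  obtain ⟨m₁, hm₁⟩ := hS.exists_isThreshold h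
  refine le_antisymm ?_ (hS.mul_le_optValue h.toIsSurvival h.peak_mem_Icc)
  refine (hS.optValue_le_of_threshold_le h hm₁ hm₁.lt_peak.le).trans_eq ?_
  have hGz := h.pos h.peak_mem.2
  have := Real.rpow_pos_of_pos hGz α
  rw [max_self, jumpProfit, Real.rpow_neg hGz.le,
    Real.rpow_one_add' hGz.le (by linarith [hS.alpha_pos])]
  field_simp

lemma optValue_pos (hS : StationaryLoan ρ α δ K) (h : HasPeak α G z) {m : ℝ} (hm0 : 0 ≤ m)
    (hm : m < 1) : 0 < optValue ρ (constElasticityDemand α) G m := by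
  obtain ⟨y, hmy, hy⟩ := exists_between hm
  have hy0 : 0 < y := hm0.trans_lt hmy
  refine lt_of_lt_of_le ?_ (hS.jump_le_optValue h.toIsSurvival hy0 hmy.le hy.le (h.pos hm))
  exact mul_pos (mul_pos hS.value_pos (Real.rpow_pos_of_pos (h.pos hm) _))
    (mul_pos hy0 (Real.rpow_pos_of_pos (h.pos hy) _))

lemma disc_pos_of_isOptStep (hS : StationaryLoan ρ α δ K) (h : HasPeak α G z) {m y d : ℝ}
    (hm0 : 0 ≤ m) (hm : m < 1) (hstep : IsOptStep ρ (constElasticityDemand α) G m y d) :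
    0 < d := by
  refine hstep.disc_mem.1.lt_of_ne ?_
  rintro rfl
  refine (hS.optValue_pos h hm0 hm).ne' ?_
  rw [hstep.optValue_eq, bellman, constElasticityDemand, Real.zero_rpow hS.alpha_pos.ne', zero_mul]

lemma demand_pos_of_isOptStep (hS : StationaryLoan ρ α δ K) (h : HasPeak α G z) {m y d : ℝ}
    (hm0 : 0 ≤ m) (hm : m < 1) (hstep : IsOptStep ρ (constElasticityDemand α) G m y d) :
    0 < constElasticityDemand α d :=
  Real.rpow_pos_of_pos (hS.disc_pos_of_isOptStep h hm0 hm hstep) α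

lemma mul_lt_optValue (hS : StationaryLoan ρ α δ K) (h : HasPeak α G z) {m₁ : ℝ}
    (hm₁ : IsThreshold α δ G z m₁) {m : ℝ} (hm0 : 0 ≤ m) (hm : m < m₁) :
    m * G m < α * optValue ρ (constElasticityDemand α) G m := by
  have hα := hS.alpha_pos
  have hmz : m < z := hm.trans hm₁.lt_peak
  have hGm := h.pos (hmz.trans h.peak_mem.2)
  have := Real.rpow_pos_of_pos hGm α
  have hjump := hS.jump_le_optValue h.toIsSurvival h.peak_mem.1 hmz.le h.peak_mem.2.le hGm
  have hlt := h.strictMonoOn_jumpProfit ⟨hm0, hmz.le⟩ ⟨hm₁.pos.le, hm₁.lt_peak.le⟩ hm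
  rw [hm₁.jumpProfit_eq, ← hS.mul_value] at hlt
  calc m * G m = jumpProfit α G m * G m ^ (-α) := by
        rw [jumpProfit, Real.rpow_one_add' hGm.le (by positivity), Real.rpow_neg hGm.le]
        field_simp
    _ < α * K * jumpProfit α G z * G m ^ (-α) :=
        mul_lt_mul_of_pos_right hlt (Real.rpow_pos_of_pos hGm _)
    _ = α * (K * G m ^ (-α) * jumpProfit α G z) := by ring
    _ ≤ _ := mul_le_mul_of_nonneg_left hjump hα.le

/-- The value of learning exceeds the profit from lending at the present record. -/
lemma lt_of_isOptStep (hS : StationaryLoan ρ α δ K) (h : HasPeak α G z) {m₁ : ℝ}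
    (hm₁ : IsThreshold α δ G z m₁) {m y d : ℝ} (hm0 : 0 ≤ m) (hm : m < m₁)
    (hstep : IsOptStep ρ (constElasticityDemand α) G m y d) : m < y := by
  by_contra! hym
  have hα := hS.alpha_pos
  have hd := hstep.disc_mem
  have hvalue := hS.optValue_pos h hm0 (hm.trans (hm₁.lt_peak.trans h.peak_mem.2))
  have heq := hstep.optValue_eq
  rw [bellman_of_ge hym, constElasticityDemand] at heq
  set V := optValue ρ (constElasticityDemand α) G m
  have hprofit : y * G m ≤ α * V :=
    (mul_le_mul_of_nonneg_right hym (h.nonneg m)).trans (hS.mul_lt_optValue h hm₁ hm0 hm).le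
  have hyoung := young_rpow_le hα hd.1 hS.rho_pos.le
  have hρ : ρ ^ (1 + α) < 1 := Real.rpow_lt_one hS.rho_pos.le hS.rho_lt_one (by positivity)
  have : V < V := calc
    V ≤ d ^ α * ((ρ - d) * (α * V) + ρ * V) :=
        heq.trans_le (mul_le_mul_of_nonneg_left
          (by linarith [mul_le_mul_of_nonneg_left hprofit (sub_nonneg.2 hd.2)])
          (Real.rpow_nonneg hd.1 _))
    _ = ((1 + α) * d ^ α * ρ - α * d ^ (1 + α)) * V := by
        rw [Real.rpow_one_add' hd.1 (by positivity)]
        ring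
    _ ≤ ρ ^ (1 + α) * V := mul_le_mul_of_nonneg_right (by linarith) hvalue.le
    _ < V := mul_lt_of_lt_one_left hvalue hρ
  exact lt_irrefl V this

lemma isOptStep_peak (hS : StationaryLoan ρ α δ K) (h : HasPeak α G z) {m₁ : ℝ}
    (hm₁ : IsThreshold α δ G z m₁) {m y d : ℝ} (hm : m < m₁) (hy : m₁ ≤ y)
    (hstep : IsOptStep ρ (constElasticityDemand α) G m y d) :
    IsOptStep ρ (constElasticityDemand α) G m z (δ * (G z / G m)) := by
  have hz := h.peak_mem
  have hmz : m < z := hm.trans hm₁.lt_peak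
  have hm1 : m < 1 := hmz.trans hz.2
  have hGm := h.pos hm1
  have hdisc := hS.jump_disc_mem h.toIsSurvival hmz.le hGm
  refine ⟨h.peak_mem_Icc, hdisc, le_antisymm ?_
    (hS.isLendingMarket.bellman_le_optValue h.toIsSurvival m h.peak_mem_Icc hdisc)⟩
  calc optValue ρ (constElasticityDemand α) G m
      = bellman ρ (constElasticityDemand α) G (optValue ρ (constElasticityDemand α) G) m y d :=
        hstep.optValue_eq
    _ ≤ K * G m ^ (-α) * jumpProfit α G (max y z) := by
        rw [bellman_of_le (hm.le.trans hy)]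
        exact hS.step_le_of_threshold_le h hm₁ hm1 hy hstep.repay_mem.2 hstep.disc_mem.1
          (hS.optValue_le_of_threshold_le h hm₁ hy)
    _ ≤ K * G m ^ (-α) * jumpProfit α G z := by
        have hmax := h.jumpProfit_max_le_jumpProfit_max hstep.repay_mem.1 hstep.repay_mem.2
        rw [max_eq_right hz.1.le] at hmax
        exact mul_le_mul_of_nonneg_left hmax
          (mul_nonneg hS.value_pos.le (Real.rpow_nonneg hGm.le _))
    _ ≤ _ := hS.jump_le_bellman h.toIsSurvival hz.1 hmz.le hz.2.le hGm

/-- If a loan below the threshold did not lose money, a higher discount rate would be better. -/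
lemma loss_of_isOptStep (hS : StationaryLoan ρ α δ K) (h : HasPeak α G z) {m₁ : ℝ}
    (hm₁ : IsThreshold α δ G z m₁) {m y d : ℝ} (hm0 : 0 ≤ m) (hmy : m < y) (hy : y < m₁)
    (hstep : IsOptStep ρ (constElasticityDemand α) G m y d) : ρ * G y < d * G m := by
  by_contra! hgain
  have hα := hS.alpha_pos
  have hρ := hS.rho_pos
  have hy0 : 0 < y := hm0.trans_lt hmy
  have hy1 : y < 1 := hy.trans (hm₁.lt_peak.trans h.peak_mem.2)
  have hGm := h.pos (hmy.trans hy1)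
  have hB : 0 < y * G m := mul_pos hy0 hGm
  have hdρ : d < ρ := by
    have hGlt := h.strictAntiOn ⟨hm0, (hmy.trans hy1).le⟩ ⟨hy0.le, hy1.le⟩ hmy
    exact lt_of_mul_lt_mul_right (hgain.trans_lt (mul_lt_mul_of_pos_left hGlt hρ)) hGm.le
  have hmargin : d < α * (ρ * (y * G y + optValue ρ (constElasticityDemand α) G y))
      / ((1 + α) * (y * G m)) := by
    rw [lt_div_iff₀ (by positivity)]
    have hvalue := mul_lt_mul_of_pos_left (hS.mul_lt_optValue h hm₁ hy0.le hy) hρ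
    linarith [mul_le_mul_of_nonneg_left hgain (mul_nonneg hα.le hy0.le),
      mul_le_mul_of_nonneg_left hgain hy0.le]
  obtain ⟨e, hde, he⟩ := exists_between (lt_min hdρ hmargin)
  obtain ⟨heρ, hemargin⟩ := lt_min_iff.1 he
  rw [lt_div_iff₀ (by positivity)] at hemargin
  have hbetter := rpow_mul_sub_lt_rpow_mul_sub
    (A := ρ * (y * G y + optValue ρ (constElasticityDemand α) G y)) hα
    hstep.disc_mem.1 hde hB (by linarith)
  have hopt := hS.isLendingMarket.bellman_le_optValue h.toIsSurvival m hstep.repay_mem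
    ⟨hstep.disc_mem.1.trans hde.le, heρ.le⟩
  rw [hstep.optValue_eq, bellman_of_le hmy.le, bellman_of_le hmy.le] at hopt
  exact hopt.not_gt hbetter

lemma growth_of_isOptStep (hS : StationaryLoan ρ α δ K) (h : HasPeak α G z) {m₁ : ℝ}
    (hm₁ : IsThreshold α δ G z m₁) {m y d y' d' : ℝ} (hm0 : 0 ≤ m) (hmy : m < y) (hy : y < m₁)
    (hstep : IsOptStep ρ (constElasticityDemand α) G m y d)
    (hstep' : IsOptStep ρ (constElasticityDemand α) G y y' d') :
    y ≤ constElasticityDemand α d' * d' * y' :=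
  hS.isLendingMarket.le_mul_of_isOptStep_of_loss h.toIsSurvival hm0 hmy.le
    (hS.lt_of_isOptStep h hm₁ (hm0.trans hmy.le) hy hstep').le
    (hS.demand_pos_of_isOptStep h hm0 (hmy.trans (hy.trans (hm₁.lt_peak.trans h.peak_mem.2))) hstep)
    hstep hstep' (hS.loss_of_isOptStep h hm₁ hm0 hmy hy hstep)

lemma isScreeningPlan_jump (hS : StationaryLoan ρ α δ K) (h : HasPeak α G z) {m₁ : ℝ}
    (hm₁ : IsThreshold α δ G z m₁) {m y d : ℝ} (hm0 : 0 ≤ m) (hm : m < m₁) (hy : m₁ ≤ y)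
    (hstep : IsOptStep ρ (constElasticityDemand α) G m y d) :
    ∃ d' P, IsScreeningPlan ρ (constElasticityDemand α) G z m₁ m z d' 0 P := by
  have hmz : m < z := hm.trans hm₁.lt_peak
  have hjump := hS.isOptStep_peak h hm₁ hm hy hstep
  have hdemand := hS.demand_pos_of_isOptStep h hm0 (hmz.trans h.peak_mem.2) hjump
  have hgain := mul_pos hS.rho_pos hdemand
  refine ⟨δ * (G z / G m), ρ * constElasticityDemand α (δ * (G z / G m)) * ((1 + K) * z), hjump,
    ?_, zero_mem _, ?_, fun G' hG' v hv => ?_⟩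
  · exact mul_pos hgain (mul_pos (by linarith [hS.value_pos]) h.peak_mem.1)
  · rw [hjump.optValue_eq, bellman_of_le hmz.le, hS.optValue_peak h, LinearMap.zero_apply]
    ring
  · refine le_trans ?_
      (hS.isLendingMarket.bellman_le_optValue hG' v h.peak_mem_Icc hjump.disc_mem)
    rw [bellman_of_le (hv.2.trans hmz.le), LinearMap.zero_apply]
    linarith [mul_le_mul_of_nonneg_left (hS.mul_le_optValue hG' h.peak_mem_Icc) hgain.le]

/-- The repayment amounts of screening loans grow at least by the factor `ρ⁻¹`, so that they reach
the threshold after finitely many steps. -/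
lemma exists_isScreeningPlan_of_le (hS : StationaryLoan ρ α δ K) (h : HasPeak α G z) {m₁ : ℝ}
    (hm₁ : IsThreshold α δ G z m₁) (k : ℕ) {m y d : ℝ} (hm0 : 0 ≤ m) (hm : m < m₁)
    (hstep : IsOptStep ρ (constElasticityDemand α) G m y d) (hy : m₁ * ρ ^ k ≤ y) :
    ∃ y' d' C P, IsScreeningPlan ρ (constElasticityDemand α) G z m₁ m y' d' C P := by
  induction k generalizing m y d with
  | zero =>
    obtain ⟨d', P, hplan⟩ := hS.isScreeningPlan_jump h hm₁ hm0 hm (by simpa using hy) hstep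
    exact ⟨z, d', 0, P, hplan⟩
  | succ k ih =>
    rcases le_or_gt m₁ y with hm₁y | hym₁
    · obtain ⟨d', P, hplan⟩ := hS.isScreeningPlan_jump h hm₁ hm0 hm hm₁y hstep
      exact ⟨z, d', 0, P, hplan⟩
    have hs := hS.isLendingMarket
    have hmy := hS.lt_of_isOptStep h hm₁ hm0 hm hstep
    have hy0 : 0 < y := hm0.trans_lt hmy
    obtain ⟨y₂, d₂, hstep₂⟩ := hs.exists_isOptStep h.toIsSurvival y
    have hy₂ : m₁ * ρ ^ k ≤ y₂ := by
      refine le_of_mul_le_mul_left ?_ hS.rho_pos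
      calc ρ * (m₁ * ρ ^ k) = m₁ * ρ ^ (k + 1) := by ring
        _ ≤ y := hy
        _ ≤ constElasticityDemand α d₂ * d₂ * y₂ :=
            hS.growth_of_isOptStep h hm₁ hm0 hmy hym₁ hstep hstep₂
        _ ≤ ρ * y₂ := mul_le_mul_of_nonneg_right ((mul_le_of_le_one_left hstep₂.disc_mem.1
            (hs.mapsTo hstep₂.disc_mem).2).trans hstep₂.disc_mem.2) hstep₂.repay_mem.1
    obtain ⟨y', d', C, P, hplan⟩ := ih hy0.le hym₁ hstep₂ hy₂
    exact ⟨y, d, _, _, hplan.cons hs hS.rho_pos hstep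
      (hS.demand_pos_of_isOptStep h hm0 (hm.trans (hm₁.lt_peak.trans h.peak_mem.2)) hstep)
      hmy.le ⟨hy0, hym₁⟩ (hS.growth_of_isOptStep h hm₁ hm0 hmy hym₁ hstep hplan.isOptStep)⟩

theorem exists_affine_le_optValue (hS : StationaryLoan ρ α δ K) (h : HasPeak α G z) :
    ∃ m₁ ∈ Set.Ioo 0 z, ∃ C ∈ screeningLosses m₁, ∃ P > 0, ∃ e ≥ 0,
      optValue ρ (constElasticityDemand α) G 0 = P * G z - C G - e ∧
      ∀ G', IsSurvival G' → P * G' z - C G' - e ≤ optValue ρ (constElasticityDemand α) G' 0 := by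
  obtain ⟨m₁, hm₁⟩ := hS.exists_isThreshold h
  have hs := hS.isLendingMarket
  obtain ⟨y, d, hstep⟩ := hs.exists_isOptStep h.toIsSurvival 0
  have hy := hS.lt_of_isOptStep h hm₁ le_rfl hm₁.pos hstep
  obtain ⟨k, hk⟩ := exists_pow_lt_of_lt_one (div_pos hy hm₁.pos) hS.rho_lt_one
  rw [lt_div_iff₀' hm₁.pos] at hk
  obtain ⟨y', d', C, P, hplan⟩ :=
    hS.exists_isScreeningPlan_of_le h hm₁ k le_rfl hm₁.pos hstep hk.le
  have hstep' := hplan.isOptStep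
  refine ⟨m₁, ⟨hm₁.pos, hm₁.lt_peak⟩, C, hplan.loss_mem, P, hplan.gain_pos,
    constElasticityDemand α d' * d' * y',
    mul_nonneg (mul_nonneg (hs.mapsTo hstep'.disc_mem).1 hstep'.disc_mem.1) hstep'.repay_mem.1,
    ?_, fun G' hG' => ?_⟩
  · simpa [h.eq_one 0 le_rfl] using hplan.value_eq
  · simpa [hG'.eq_one 0 le_rfl] using hplan.le_value G' hG' 0 ⟨le_rfl, le_rfl⟩

lemma optValue_zero_le (hS : StationaryLoan ρ α δ K) (hG : IsSurvival G) {T : ℝ → ℝ}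
    (hT : AntitoneOn T (Set.Ici 0)) (hTG : ∀ y, 0 ≤ y → y * G y ≤ T y) :
    optValue ρ (constElasticityDemand α) G 0 ≤ K * T 0 := by
  have hK := hS.value_pos.le
  have hT0 : ∀ y, 0 ≤ y → 0 ≤ T y := fun y hy =>
    (mul_nonneg hy (hG.nonneg y)).trans (hTG y hy)
  refine hS.isLendingMarket.optValue_le_of_bellman_le (m₀ := 0) (W := fun m => K * T m) hG
    (fun m hm => mul_nonneg hK (hT0 m hm)) (fun m hm y hy d hd => ?_) le_rfl
  have hmax : 0 ≤ max m y := le_max_of_le_left hm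
  have hprofit : y * (ρ * G (max m y) - d * G m) ≤ (ρ - d) * T (max m y) := by
    have hyT : y * G (max m y) ≤ T (max m y) :=
      (mul_le_mul_of_nonneg_right (le_max_right _ _) (hG.nonneg _)).trans (hTG _ hmax)
    linarith [mul_le_mul_of_nonneg_left (hG.antitone (le_max_left m y)) (mul_nonneg hy.1 hd.1),
      mul_le_mul_of_nonneg_left hyT (sub_nonneg.2 hd.2)]
  have hdemand := Real.rpow_nonneg hd.1 α
  calc d ^ α * (y * (ρ * G (max m y) - d * G m) + ρ * (K * T (max m y)))
      ≤ d ^ α * ((ρ - d) * T (max m y) + ρ * (K * T (max m y))) := by gcongr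
    _ = d ^ α * (ρ * (1 + K) - d) * T (max m y) := by ring
    _ ≤ K * T (max m y) := mul_le_mul_of_nonneg_right (hS.profit_le_value hd.1) (hT0 _ hmax)
    _ ≤ K * T m := mul_le_mul_of_nonneg_left (hT hm hmax (le_max_left _ _)) hK

end StationaryLoan

end OptimalPlan

/-! ### Lending policies -/

section LendingPolicies

lemma le_record_of_lt {m : ℝ} {y : ℕ → ℝ} {i t : ℕ} (h : i < t) : y i ≤ record m y t :=
  (le_max_right _ _).trans <|
    monotone_nat_of_le_succ (f := record m y) (fun _ => le_max_left _ _) (Nat.succ_le_of_lt h)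

lemma record_min_one {m : ℝ} (hm : m ≤ 1) (y : ℕ → ℝ) (t : ℕ) :
    record m (fun i => min (y i) 1) t = min (record m y t) 1 := by
  induction t with
  | zero => exact (min_eq_left hm).symm
  | succ t ih =>
    simp only [record, ih]
    exact (min_max_distrib_right _ _ _).symm

lemma IsSurvival.apply_min_one {G : ℝ → ℝ} (hG : IsSurvival G) (y : ℝ) : G (min y 1) = G y := by
  rcases le_total y 1 with h | h
  · rw [min_eq_left h]
  · rw [min_eq_right h, hG.eq_zero y h, hG.eq_zero 1 le_rfl]

/-- The survival function of a law: the probability of an income of at least `y`. -/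
noncomputable def survival (μ : Measure ℝ) (y : ℝ) : ℝ := μ.real (Set.Ici y)

namespace LendingPolicy

variable {ρ : ℝ} {s : ℝ → ℝ} {μ : Measure ℝ} [IsProbabilityMeasure μ]

/-- The plan that follows the policy `p`, with the repayment amounts capped at the largest possible
income. -/
def cappedPlan (p : LendingPolicy ρ) (t : ℕ) : ℝ × ℝ := (min (p.repay t) 1, p.disc t)

lemma cappedPlan_mem_plans (p : LendingPolicy ρ) : p.cappedPlan ∈ plans ρ :=
  fun t _ => ⟨⟨le_min (p.repay_nonneg t) zero_le_one, min_le_right _ _⟩, p.disc_mem t⟩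

lemma history_succ (p : LendingPolicy ρ) (t : ℕ) :
    p.history (t + 1) = p.history t ∩ Set.Ici (p.repay t) := by
  ext θ
  exact Nat.forall_lt_succ_right

lemma measurableSet_history (p : LendingPolicy ρ) (t : ℕ) : MeasurableSet (p.history t) := by
  induction t with
  | zero => simp [history]
  | succ t ih =>
    rw [history_succ]
    exact ih.inter measurableSet_Ici

lemma history_inter_Ici (p : LendingPolicy ρ) (t : ℕ) :
    p.history t ∩ Set.Ici 0 = Set.Ici (record 0 p.repay t) := by
  induction t with
  | zero => simp [history, record]
  | succ t ih => rw [history_succ, Set.inter_right_comm, ih, record, Set.Ici_inter_Ici]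

lemma real_history (hG : IsSurvival (survival μ)) (p : LendingPolicy ρ) (t : ℕ) :
    μ.real (p.history t) = survival μ (record 0 p.repay t) := by
  have hmem : Set.Ici 0 ∈ ae μ := by
    rw [mem_ae_iff_prob_eq_one measurableSet_Ici, ← ENNReal.toReal_eq_one_iff]
    exact hG.eq_one 0 le_rfl
  rw [survival, ← history_inter_Ici, Set.inter_comm]
  exact congrArg ENNReal.toReal (Measure.measure_inter_eq_of_ae hmem).symm

lemma survival_mul_repayProb (hG : IsSurvival (survival μ)) (p : LendingPolicy ρ) (t : ℕ) :
    survival μ (record 0 p.repay t) * p.repayProb μ t = survival μ (record 0 p.repay (t + 1)) := by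
  rw [← real_history hG, ← real_history hG, history_succ, repayProb, mul_comm]
  exact ENNReal.toReal_mul.symm.trans
    (congrArg ENNReal.toReal (cond_mul_eq_inter (p.measurableSet_history t) _ μ))

lemma prod_repayProb (hG : IsSurvival (survival μ)) (p : LendingPolicy ρ) (t : ℕ) :
    ∏ i ∈ Finset.range t, p.repayProb μ i = survival μ (record 0 p.repay t) := by
  induction t with
  | zero => exact (hG.eq_one 0 le_rfl).symm
  | succ t ih => rw [Finset.prod_range_succ, ih, survival_mul_repayProb hG]

lemma cashFlow_eq_flow (hG : IsSurvival (survival μ)) (p : LendingPolicy ρ) (t : ℕ) :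
    p.cashFlow s μ t = flow ρ s (survival μ) 0 (fun i => (p.repay i, p.disc i)) t := by
  rw [cashFlow, flow, Finset.prod_mul_distrib, prod_repayProb hG, Finset.prod_range_succ,
    ← survival_mul_repayProb hG]
  ring

lemma cashFlow_le_flow_cappedPlan (hs : IsLendingMarket ρ s) (hG : IsSurvival (survival μ))
    (p : LendingPolicy ρ) (t : ℕ) :
    p.cashFlow s μ t ≤ flow ρ s (survival μ) 0 p.cappedPlan t := by
  rw [cashFlow_eq_flow hG]
  simp only [flow, cappedPlan]
  rw [record_min_one zero_le_one, record_min_one zero_le_one, hG.apply_min_one, hG.apply_min_one]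
  refine mul_le_mul_of_nonneg_left ?_ (mul_nonneg (pow_nonneg hs.rho_nonneg t)
    (Finset.prod_nonneg fun i _ => (hs.mapsTo (p.disc_mem i)).1))
  rcases le_total (p.repay t) 1 with h | h
  · rw [min_eq_left h]
  · have hloss := mul_nonneg (p.disc_mem t).1 (hG.nonneg (record 0 p.repay t))
    rw [min_eq_right h, hG.eq_zero _ (h.trans (le_record_of_lt t.lt_succ_self))]
    linarith [mul_le_mul_of_nonneg_right h hloss]

lemma summable_cashFlow (hs : IsLendingMarket ρ s) (hG : IsSurvival (survival μ))
    (p : LendingPolicy ρ) : Summable fun t => p.cashFlow s μ t := by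
  simp only [cashFlow_eq_flow hG]
  by_cases h : ∀ t, p.repay t ≤ 1
  · exact hs.summable_flow hG 0 fun t _ => ⟨⟨p.repay_nonneg t, h t⟩, p.disc_mem t⟩
  · push Not at h
    obtain ⟨N, hN⟩ := h
    refine summable_of_ne_finset_zero (s := Finset.range (N + 1)) fun t ht => ?_
    have hNt : N < t := by simpa [Nat.lt_succ_iff] using ht
    rw [flow, hG.eq_zero _ (hN.le.trans (le_record_of_lt (hNt.trans t.lt_succ_self))),
      hG.eq_zero _ (hN.le.trans (le_record_of_lt hNt))]
    simp

lemma isGreatest_optValue (hs : IsLendingMarket ρ s) (hG : IsSurvival (survival μ)) :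
    IsGreatest (Set.range fun p : LendingPolicy ρ => p.expectedNPV s μ)
      (optValue ρ s (survival μ) 0) := by
  constructor
  · obtain ⟨q, hq, hq_opt⟩ := hs.exists_planValue_eq_optValue hG 0
    have hmem := fun t => hq t trivial
    refine ⟨⟨fun t => (q t).1, fun t => (q t).2, fun t => (hmem t).1.1, fun t => (hmem t).2⟩, ?_⟩
    simp only [expectedNPV, cashFlow_eq_flow hG]
    exact hq_opt
  · rintro _ ⟨p, rfl⟩
    exact ((p.summable_cashFlow hs hG).tsum_le_tsum (p.cashFlow_le_flow_cappedPlan hs hG)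
      (hs.summable_flow hG 0 p.cappedPlan_mem_plans)).trans
      (hs.planValue_le_optValue hG 0 p.cappedPlan_mem_plans)

end LendingPolicy

lemma optimalNPV_eq_optValue {ρ : ℝ} {s : ℝ → ℝ} {μ : Measure ℝ} [IsProbabilityMeasure μ]
    (hs : IsLendingMarket ρ s) (hG : IsSurvival (survival μ)) :
    optimalNPV ρ s μ = optValue ρ s (survival μ) 0 :=
  (LendingPolicy.isGreatest_optValue hs hG).csSup_eq

end LendingPolicies

/-! ### Beta laws -/

section BetaLaw

variable {a b : ℝ}

lemma betaPDFReal_eq_of_mem_Ioo {x : ℝ} (hx : x ∈ Set.Ioo (0 : ℝ) 1) :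
    betaPDFReal a b x = (beta a b)⁻¹ * (x ^ (a - 1) * (1 - x) ^ (b - 1)) := by
  rw [betaPDFReal, if_pos (Set.mem_Ioo.1 hx), one_div, mul_assoc]

lemma betaPDFReal_eq_zero_of_notMem_Ioo {x : ℝ} (hx : x ∉ Set.Ioo (0 : ℝ) 1) :
    betaPDFReal a b x = 0 :=
  if_neg hx

lemma betaPDFReal_nonneg (ha : 0 < a) (hb : 0 < b) (x : ℝ) : 0 ≤ betaPDFReal a b x := by
  by_cases hx : x ∈ Set.Ioo (0 : ℝ) 1
  · exact (betaPDFReal_pos hx.1 hx.2 ha hb).le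
  · exact (betaPDFReal_eq_zero_of_notMem_Ioo hx).ge

lemma integrable_betaPDFReal (ha : 0 < a) (hb : 0 < b) : Integrable (betaPDFReal a b) := by
  refine ⟨(measurable_betaPDFReal a b).aestronglyMeasurable, ?_⟩
  rw [hasFiniteIntegral_iff_ofReal (Filter.Eventually.of_forall (betaPDFReal_nonneg ha hb))]
  exact (lintegral_betaPDF_eq_one ha hb).trans_lt ENNReal.one_lt_top

lemma continuousOn_betaPDFReal (a b : ℝ) : ContinuousOn (betaPDFReal a b) (Set.Ioo 0 1) := by
  refine ContinuousOn.congr (f := fun x => (beta a b)⁻¹ * (x ^ (a - 1) * (1 - x) ^ (b - 1))) ?_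
    fun x hx => betaPDFReal_eq_of_mem_Ioo hx
  exact continuousOn_const.mul
    ((continuousOn_id.rpow_const fun x hx => Or.inl hx.1.ne').mul
      (ContinuousOn.rpow_const (by fun_prop) fun x hx => Or.inl (sub_pos.2 hx.2).ne'))

lemma measurable_betaPDF (a b : ℝ) : Measurable (betaPDF a b) :=
  (measurable_betaPDFReal a b).ennreal_ofReal

lemma ae_mem_Ioo_betaMeasure (a b : ℝ) : ∀ᵐ x ∂betaMeasure a b, x ∈ Set.Ioo (0 : ℝ) 1 := by
  rw [betaMeasure, ae_withDensity_iff (measurable_betaPDF a b)]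
  refine Filter.Eventually.of_forall fun x hx => ?_
  contrapose! hx
  rw [betaPDF, betaPDFReal_eq_zero_of_notMem_Ioo hx, ENNReal.ofReal_zero]

lemma memLp_id_betaMeasure (ha : 0 < a) (hb : 0 < b) (p : ENNReal) :
    MemLp id p (betaMeasure a b) := by
  have := isProbabilityMeasureBeta ha hb
  refine MemLp.of_bound measurable_id.aestronglyMeasurable 1 ?_
  filter_upwards [ae_mem_Ioo_betaMeasure a b] with x hx
  exact abs_le.2 ⟨by linarith [hx.1, id_eq x], hx.2.le⟩

lemma beta_add_one_left (ha : 0 < a) (hb : 0 < b) :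
    beta (a + 1) b = a / (a + b) * beta a b := by
  have hab : 0 < a + b := add_pos ha hb
  have := (Real.Gamma_pos_of_pos hab).ne'
  rw [beta, beta, Real.Gamma_add_one ha.ne', show a + 1 + b = a + b + 1 by ring,
    Real.Gamma_add_one hab.ne']
  field_simp

lemma integral_id_mul_betaMeasure (ha : 0 < a) (hb : 0 < b) (g : ℝ → ℝ) :
    ∫ x, x * g x ∂betaMeasure a b = a / (a + b) * ∫ x, g x ∂betaMeasure (a + 1) b := by
  have hdensity : ∀ {a : ℝ}, 0 < a → ∀ g : ℝ → ℝ,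
      ∫ x, g x ∂betaMeasure a b = ∫ x, betaPDFReal a b x * g x := fun ha g => by
    rw [betaMeasure, integral_withDensity_eq_integral_toReal_smul (measurable_betaPDF _ b)
      (Filter.Eventually.of_forall fun x => ENNReal.ofReal_lt_top)]
    simp only [betaPDF, ENNReal.toReal_ofReal (betaPDFReal_nonneg ha hb _), smul_eq_mul]
  rw [hdensity ha, hdensity (by positivity), ← integral_const_mul]
  congr 1
  ext x
  by_cases hx : x ∈ Set.Ioo (0 : ℝ) 1
  · have := beta_pos ha hb
    rw [betaPDFReal_eq_of_mem_Ioo hx, betaPDFReal_eq_of_mem_Ioo hx, beta_add_one_left ha hb,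
      show a + 1 - 1 = a - 1 + 1 by ring, Real.rpow_add_one hx.1.ne']
    field_simp
  · rw [betaPDFReal_eq_zero_of_notMem_Ioo hx, betaPDFReal_eq_zero_of_notMem_Ioo hx]
    ring

lemma integral_id_betaMeasure (ha : 0 < a) (hb : 0 < b) :
    ∫ x, x ∂betaMeasure a b = a / (a + b) := by
  have := isProbabilityMeasureBeta (add_pos ha one_pos) hb
  simpa using integral_id_mul_betaMeasure ha hb fun _ => 1

lemma variance_id_betaMeasure (ha : 0 < a) (hb : 0 < b) :
    variance id (betaMeasure a b) = a * b / ((a + b) ^ 2 * (a + b + 1)) := by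
  have := isProbabilityMeasureBeta ha hb
  rw [variance_eq_sub (memLp_id_betaMeasure ha hb 2)]
  simp only [Pi.pow_apply, id_eq, pow_two]
  rw [integral_id_mul_betaMeasure ha hb, integral_id_betaMeasure (by positivity) hb,
    integral_id_betaMeasure ha hb]
  field_simp
  ring

/-- The survival function of the Beta law with parameters `a` and `b`. -/
noncomputable abbrev betaSurvival (a b : ℝ) : ℝ → ℝ := survival (betaMeasure a b)

lemma betaSurvival_sub (ha : 0 < a) (hb : 0 < b) (x y : ℝ) :
    betaSurvival a b x - betaSurvival a b y = ∫ t in x..y, betaPDFReal a b t := by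
  have hf := integrable_betaPDFReal ha hb
  have htail : ∀ y, betaSurvival a b y = ∫ t in Set.Ioi y, betaPDFReal a b t := fun y => by
    rw [betaSurvival, survival, betaMeasure, measureReal_def,
      withDensity_apply _ measurableSet_Ici, integral_eq_lintegral_of_nonneg_ae
        (Filter.Eventually.of_forall (betaPDFReal_nonneg ha hb))
        (measurable_betaPDFReal a b).aestronglyMeasurable, restrict_Ioi_eq_restrict_Ici]
    rfl
  rw [htail, htail, intervalIntegral.integral_Ioi_sub_Ioi' hf.integrableOn hf.integrableOn]

lemma betaSurvival_of_nonpos (ha : 0 < a) (hb : 0 < b) {y : ℝ} (hy : y ≤ 0) :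
    betaSurvival a b y = 1 := by
  have := isProbabilityMeasureBeta ha hb
  have hmem : Set.Ici y ∈ ae (betaMeasure a b) := by
    filter_upwards [ae_mem_Ioo_betaMeasure a b] with x hx using hy.trans hx.1.le
  exact ENNReal.toReal_eq_one_iff _ |>.2 ((mem_ae_iff_prob_eq_one measurableSet_Ici).1 hmem)

lemma betaSurvival_of_one_le (a b : ℝ) {y : ℝ} (hy : 1 ≤ y) : betaSurvival a b y = 0 := by
  have hnull : betaMeasure a b (Set.Ici y) = 0 := by
    rw [measure_eq_zero_iff_ae_notMem]
    filter_upwards [ae_mem_Ioo_betaMeasure a b] with x hx using not_le.2 (hx.2.trans_le hy)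
  rw [betaSurvival, survival, measureReal_def, hnull, ENNReal.toReal_zero]

lemma betaSurvival_eq_one_sub_integral (ha : 0 < a) (hb : 0 < b) (y : ℝ) :
    betaSurvival a b y = 1 - ∫ t in (0 : ℝ)..y, betaPDFReal a b t := by
  rw [← betaSurvival_sub ha hb, betaSurvival_of_nonpos ha hb le_rfl, sub_sub_cancel]

lemma isSurvival_betaSurvival (ha : 0 < a) (hb : 0 < b) : IsSurvival (betaSurvival a b) where
  continuous := by
    rw [funext (betaSurvival_eq_one_sub_integral ha hb)]
    exact continuous_const.sub (intervalIntegral.continuous_primitive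
      (fun _ _ => (integrable_betaPDFReal ha hb).intervalIntegrable) 0)
  antitone x y hxy := by
    have := isProbabilityMeasureBeta ha hb
    exact measureReal_mono (Set.Ici_subset_Ici.2 hxy)
  eq_one _ := betaSurvival_of_nonpos ha hb
  eq_zero _ := betaSurvival_of_one_le a b

lemma hasDerivAt_betaSurvival (ha : 0 < a) (hb : 0 < b) {y : ℝ} (hy : y ∈ Set.Ioo (0 : ℝ) 1) :
    HasDerivAt (betaSurvival a b) (-betaPDFReal a b y) y := by
  rw [funext (betaSurvival_eq_one_sub_integral ha hb)]
  exact (intervalIntegral.integral_hasDerivAt_right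
    (integrable_betaPDFReal ha hb).intervalIntegrable
    (stronglyMeasurable_betaPDFReal a b).stronglyMeasurableAtFilter
    ((continuousOn_betaPDFReal a b).continuousAt (Ioo_mem_nhds hy.1 hy.2))).const_sub 1

lemma strictAntiOn_betaSurvival (ha : 0 < a) (hb : 0 < b) :
    StrictAntiOn (betaSurvival a b) (Set.Icc 0 1) := by
  refine strictAntiOn_of_deriv_neg (convex_Icc 0 1)
    (isSurvival_betaSurvival ha hb).continuous.continuousOn fun x hx => ?_
  rw [interior_Icc] at hx
  rw [(hasDerivAt_betaSurvival ha hb hx).deriv]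
  exact neg_neg_of_pos (betaPDFReal_pos hx.1 hx.2 ha hb)

lemma betaSurvival_pos (ha : 0 < a) (hb : 0 < b) {y : ℝ} (hy : y ∈ Set.Ico (0 : ℝ) 1) :
    0 < betaSurvival a b y := by
  rw [← betaSurvival_of_one_le a b le_rfl]
  exact strictAntiOn_betaSurvival ha hb ⟨hy.1, hy.2.le⟩ ⟨zero_le_one, le_rfl⟩ hy.2

lemma continuousAt_beta (ha : 0 < a) (hb : 0 < b) :
    ContinuousAt (fun p : ℝ × ℝ => beta p.1 p.2) (a, b) := by
  have hΓ : ∀ {s : ℝ}, 0 < s → ContinuousAt Real.Gamma s := fun {s} hs =>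
    (Real.differentiableAt_Gamma fun m =>
      ((neg_nonpos.2 m.cast_nonneg).trans_lt hs).ne').continuousAt
  have hab : 0 < a + b := add_pos ha hb
  exact ((ContinuousAt.comp' (hΓ ha) continuousAt_fst).mul
    (ContinuousAt.comp' (hΓ hb) continuousAt_snd)).div
    (ContinuousAt.comp' (f := fun p : ℝ × ℝ => p.1 + p.2) (hΓ hab) (by fun_prop))
    (Real.Gamma_pos_of_pos hab).ne'

/-- The unnormalised density of the Beta law with parameters `a` and `b`. -/
noncomputable def betaKernel (a b : ℝ) : ℝ → ℝ :=
  (Set.Ioo 0 1).indicator fun x => x ^ (a - 1) * (1 - x) ^ (b - 1)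

lemma betaPDFReal_eq_inv_mul_betaKernel (a b x : ℝ) :
    betaPDFReal a b x = (beta a b)⁻¹ * betaKernel a b x := by
  by_cases hx : x ∈ Set.Ioo (0 : ℝ) 1
  · rw [betaPDFReal_eq_of_mem_Ioo hx, betaKernel, Set.indicator_of_mem hx]
  · rw [betaPDFReal_eq_zero_of_notMem_Ioo hx, betaKernel, Set.indicator_of_notMem hx, mul_zero]

lemma integrable_betaKernel (ha : 0 < a) (hb : 0 < b) : Integrable (betaKernel a b) := by
  refine ((integrable_betaPDFReal ha hb).const_mul (beta a b)).congr
    (Filter.Eventually.of_forall fun x => ?_)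
  simp only [betaPDFReal_eq_inv_mul_betaKernel, mul_inv_cancel_left₀ (beta_pos ha hb).ne']

lemma norm_betaKernel_le_of_le {a' b' : ℝ} (ha : a ≤ a') (hb : b ≤ b') (x : ℝ) :
    ‖betaKernel a' b' x‖ ≤ betaKernel a b x := by
  by_cases hx : x ∈ Set.Ioo (0 : ℝ) 1
  · have h1 : 0 < 1 - x := sub_pos.2 hx.2
    rw [betaKernel, betaKernel, Set.indicator_of_mem hx, Set.indicator_of_mem hx,
      Real.norm_of_nonneg (by have := hx.1; positivity)]
    exact mul_le_mul (Real.rpow_le_rpow_of_exponent_ge hx.1 hx.2.le (by linarith))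
      (Real.rpow_le_rpow_of_exponent_ge h1 (by linarith [hx.1]) (by linarith))
      (Real.rpow_nonneg h1.le _) (Real.rpow_nonneg hx.1.le _)
  · rw [betaKernel, betaKernel, Set.indicator_of_notMem hx, Set.indicator_of_notMem hx, norm_zero]

lemma continuous_betaKernel_params (x : ℝ) :
    Continuous fun p : ℝ × ℝ => betaKernel p.1 p.2 x := by
  by_cases hx : x ∈ Set.Ioo (0 : ℝ) 1
  · simp only [betaKernel, Set.indicator_of_mem hx]
    exact ((Real.continuous_const_rpow hx.1.ne').comp (by fun_prop)).mul
      ((Real.continuous_const_rpow (sub_pos.2 hx.2).ne').comp (by fun_prop))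
  · simpa only [betaKernel, Set.indicator_of_notMem hx] using continuous_const

lemma continuousAt_betaSurvival (ha : 0 < a) (hb : 0 < b) (y : ℝ) :
    ContinuousAt (fun p : ℝ × ℝ => betaSurvival p.1 p.2 y) (a, b) := by
  have hhalf : ∀ᶠ p : ℝ × ℝ in nhds (a, b), a / 2 < p.1 ∧ b / 2 < p.2 :=
    (lt_mem_nhds (half_lt_self ha)).prod_nhds (lt_mem_nhds (half_lt_self hb))
  have hrep : (fun p : ℝ × ℝ => 1 - (beta p.1 p.2)⁻¹ * ∫ x in (0 : ℝ)..y, betaKernel p.1 p.2 x)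
      =ᶠ[nhds (a, b)] fun p => betaSurvival p.1 p.2 y := by
    filter_upwards [hhalf] with p hp
    rw [betaSurvival_eq_one_sub_integral ((half_pos ha).trans hp.1) ((half_pos hb).trans hp.2),
      ← intervalIntegral.integral_const_mul]
    simp only [betaPDFReal_eq_inv_mul_betaKernel]
  refine ContinuousAt.congr (continuousAt_const.sub
    (((continuousAt_beta ha hb).inv₀ (beta_pos ha hb).ne').mul ?_)) hrep
  refine intervalIntegral.continuousAt_of_dominated_interval
    (bound := betaKernel (a / 2) (b / 2)) ?_ ?_ ?_ ?_
  · filter_upwards [hhalf] with p hp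
    exact (integrable_betaKernel ((half_pos ha).trans hp.1)
      ((half_pos hb).trans hp.2)).aestronglyMeasurable.restrict
  · filter_upwards [hhalf] with p hp
    exact Filter.Eventually.of_forall fun x _ => norm_betaKernel_le_of_le hp.1.le hp.2.le x
  · exact (integrable_betaKernel (half_pos ha) (half_pos hb)).intervalIntegrable
  · exact Filter.Eventually.of_forall fun x _ => (continuous_betaKernel_params x).continuousAt

end BetaLaw

section BetaPeak

variable {a b α : ℝ}

lemma mul_betaPDFReal_lt_of_le_one (ha : 0 < a) (hb : 0 < b) (hb1 : b ≤ 1) {x y : ℝ} (hx : 0 < x)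
    (hxy : x < y) (hy : y < 1) : x * betaPDFReal a b x < y * betaPDFReal a b y := by
  have hmul : ∀ {t : ℝ}, t ∈ Set.Ioo (0 : ℝ) 1 →
      t * betaPDFReal a b t = (beta a b)⁻¹ * (t ^ a * (1 - t) ^ (b - 1)) := fun {t} ht => by
    rw [betaPDFReal_eq_of_mem_Ioo ht, Real.rpow_sub_one ht.1.ne']
    have := ht.1.ne'
    field_simp
  have hx1 : 0 < 1 - x := by linarith
  rw [hmul ⟨hx, hxy.trans hy⟩, hmul ⟨hx.trans hxy, hy⟩]
  exact mul_lt_mul_of_pos_left (mul_lt_mul (Real.rpow_lt_rpow hx.le hxy ha)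
    (Real.rpow_le_rpow_of_nonpos (by linarith) (by linarith) (by linarith))
    (Real.rpow_pos_of_pos hx1 _) (Real.rpow_nonneg (hx.trans hxy).le _))
    (inv_pos.2 (beta_pos ha hb))

lemma betaPDFReal_mul_le_of_mul_eq (hb : 1 ≤ b) {x y t u : ℝ} (hx : x ∈ Set.Ioo (0 : ℝ) 1)
    (hy : y ∈ Set.Ioo (0 : ℝ) 1) (ht : t ∈ Set.Ioo (0 : ℝ) 1) (hu : u ∈ Set.Ioo (0 : ℝ) 1)
    (hmul : x * t = y * u) (hle : (1 - x) * (1 - t) ≤ (1 - y) * (1 - u)) :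
    betaPDFReal a b x * betaPDFReal a b t ≤ betaPDFReal a b y * betaPDFReal a b u := by
  have hprod : ∀ {p q : ℝ}, p ∈ Set.Ioo (0 : ℝ) 1 → q ∈ Set.Ioo (0 : ℝ) 1 →
      betaPDFReal a b p * betaPDFReal a b q
        = (beta a b)⁻¹ ^ 2 * (p * q) ^ (a - 1) * ((1 - p) * (1 - q)) ^ (b - 1) :=
    fun {p q} hp hq => by
      rw [betaPDFReal_eq_of_mem_Ioo hp, betaPDFReal_eq_of_mem_Ioo hq,
        Real.mul_rpow hp.1.le hq.1.le,
        Real.mul_rpow (sub_nonneg.2 hp.2.le) (sub_nonneg.2 hq.2.le)]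
      ring
  have hpos : 0 < y * u := mul_pos hy.1 hu.1
  rw [hprod hx ht, hprod hy hu, hmul]
  exact mul_le_mul_of_nonneg_left
    (Real.rpow_le_rpow (mul_nonneg (sub_nonneg.2 hx.2.le) (sub_nonneg.2 ht.2.le)) hle
      (sub_nonneg.2 hb)) (by positivity)

-- That is, the generalized failure rate `y * f y / G y` is strictly increasing.
lemma mul_betaPDFReal_mul_betaSurvival_lt (ha : 0 < a) (hb : 0 < b) {x y : ℝ} (hx : 0 < x)
    (hxy : x < y) (hy : y < 1) :
    x * betaPDFReal a b x * betaSurvival a b y < y * betaPDFReal a b y * betaSurvival a b x := by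
  have hy0 : 0 < y := hx.trans hxy
  have hyf : 0 < y * betaPDFReal a b y := mul_pos hy0 (betaPDFReal_pos hy0 hy ha hb)
  rcases le_total b 1 with hb1 | hb1
  · exact mul_lt_mul'' (mul_betaPDFReal_lt_of_le_one ha hb hb1 hx hxy hy)
      (strictAntiOn_betaSurvival ha hb ⟨hx.le, (hxy.trans hy).le⟩ ⟨hy0.le, hy.le⟩ hxy)
      (mul_nonneg hx.le (betaPDFReal_nonneg ha hb x)) (betaSurvival_pos ha hb ⟨hy0.le, hy⟩).le
  -- The scaling `t ↦ t * c` maps `[y, 1]` onto `[x, c]`, so the tail beyond `y` is dominated by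
  -- the part of the tail beyond `x` that stops at `c < 1`.
  obtain ⟨c, hc⟩ : ∃ c, c = x / y := ⟨_, rfl⟩
  have hc0 : 0 < c := hc ▸ div_pos hx hy0
  have hc1 : c < 1 := hc ▸ (div_lt_one hy0).2 hxy
  have hyc : y * c = x := by rw [hc, mul_div_cancel₀ _ hy0.ne']
  have hpt : ∀ t ∈ Set.Ioo y 1, betaPDFReal a b x * betaPDFReal a b t
      ≤ betaPDFReal a b y * betaPDFReal a b (t * c) := fun t ht => by
    have ht0 : 0 < t := hy0.trans ht.1
    refine betaPDFReal_mul_le_of_mul_eq hb1 ⟨hx, hxy.trans hy⟩ ⟨hy0, hy⟩ ⟨ht0, ht.2⟩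
      ⟨by positivity, mul_lt_one_of_nonneg_of_lt_one_left ht0.le ht.2 hc1.le⟩
      (by rw [← hyc]; ring) ?_
    linarith [mul_pos (sub_pos.2 ht.1) (sub_pos.2 hc1), congrArg (· * (1 - t)) hyc]
  have hint := integrable_betaPDFReal ha hb
  have hle := intervalIntegral.integral_mono_on_of_le_Ioo hy.le
    (hint.intervalIntegrable.const_mul _)
    ((hint.comp_mul_right' hc0.ne').intervalIntegrable.const_mul _) hpt
  rw [intervalIntegral.integral_const_mul, intervalIntegral.integral_const_mul,
    intervalIntegral.integral_comp_mul_right _ hc0.ne', ← betaSurvival_sub ha hb,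
    ← betaSurvival_sub ha hb, betaSurvival_of_one_le a b le_rfl, sub_zero, hyc, one_mul,
    smul_eq_mul] at hle
  calc x * betaPDFReal a b x * betaSurvival a b y
      = x * (betaPDFReal a b x * betaSurvival a b y) := mul_assoc _ _ _
    _ ≤ x * (betaPDFReal a b y * (c⁻¹ * (betaSurvival a b x - betaSurvival a b c))) :=
      mul_le_mul_of_nonneg_left hle hx.le
    _ = y * betaPDFReal a b y * (betaSurvival a b x - betaSurvival a b c) := by
      rw [← hyc]
      field_simp
    _ < y * betaPDFReal a b y * betaSurvival a b x :=
      mul_lt_mul_of_pos_left (sub_lt_self _ (betaSurvival_pos ha hb ⟨hc0.le, hc1⟩)) hyf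

/-- The derivative of the jump profit of the Beta law is this margin, up to the positive factor
`G y ^ α`. -/
noncomputable def jumpMargin (a b α y : ℝ) : ℝ :=
  betaSurvival a b y - (1 + α) * (y * betaPDFReal a b y)

lemma hasDerivAt_jumpProfit_betaSurvival (ha : 0 < a) (hb : 0 < b) {y : ℝ}
    (hy : y ∈ Set.Ioo (0 : ℝ) 1) :
    HasDerivAt (jumpProfit α (betaSurvival a b))
      (betaSurvival a b y ^ α * jumpMargin a b α y) y := by
  have hG := betaSurvival_pos ha hb (Set.Ioo_subset_Ico_self hy)
  refine ((hasDerivAt_id y).mul ((hasDerivAt_betaSurvival ha hb hy).rpow_const (p := 1 + α)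
    (Or.inl hG.ne'))).congr_deriv ?_
  rw [jumpMargin, add_sub_cancel_left, Real.rpow_add hG, Real.rpow_one]
  simp only [id_eq]
  ring

lemma jumpMargin_pos_of_lt (ha : 0 < a) (hb : 0 < b) {x y : ℝ} (hx : 0 < x)
    (hxy : x < y) (hy : y < 1) (h : 0 ≤ jumpMargin a b α y) : 0 < jumpMargin a b α x := by
  have hy0 : 0 < y := hx.trans hxy
  have hyf : 0 < y * betaPDFReal a b y := mul_pos hy0 (betaPDFReal_pos hy0 hy ha hb)
  have hxf : 0 < x * betaPDFReal a b x := mul_pos hx (betaPDFReal_pos hx (hxy.trans hy) ha hb)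
  refine sub_pos.2 (lt_of_mul_lt_mul_left ?_ hyf.le)
  calc y * betaPDFReal a b y * ((1 + α) * (x * betaPDFReal a b x))
      = x * betaPDFReal a b x * ((1 + α) * (y * betaPDFReal a b y)) := by ring
    _ ≤ x * betaPDFReal a b x * betaSurvival a b y :=
      mul_le_mul_of_nonneg_left (sub_nonneg.1 h) hxf.le
    _ < y * betaPDFReal a b y * betaSurvival a b x :=
      mul_betaPDFReal_mul_betaSurvival_lt ha hb hx hxy hy

lemma exists_jumpMargin_eq_zero (ha : 0 < a) (hb : 0 < b) (hα : 0 < α) :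
    ∃ z ∈ Set.Ioo (0 : ℝ) 1, jumpMargin a b α z = 0 := by
  have hends : jumpProfit α (betaSurvival a b) 0 = jumpProfit α (betaSurvival a b) 1 := by
    rw [jumpProfit, jumpProfit, betaSurvival_of_one_le a b le_rfl, Real.zero_rpow (by positivity)]
    ring
  obtain ⟨z, hz, hz0⟩ := exists_hasDerivAt_eq_zero zero_lt_one
    ((isSurvival_betaSurvival ha hb).continuous_jumpProfit hα).continuousOn hends
    fun y hy => hasDerivAt_jumpProfit_betaSurvival ha hb hy
  exact ⟨z, hz, (mul_eq_zero.1 hz0).resolve_left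
    (Real.rpow_pos_of_pos (betaSurvival_pos ha hb (Set.Ioo_subset_Ico_self hz)) α).ne'⟩

lemma hasPeak_of_jumpMargin_eq_zero (ha : 0 < a) (hb : 0 < b) (hα : 0 < α) {z : ℝ}
    (hz : z ∈ Set.Ioo (0 : ℝ) 1) (hz0 : jumpMargin a b α z = 0) :
    HasPeak α (betaSurvival a b) z := by
  have hG := isSurvival_betaSurvival ha hb
  have hpow : ∀ {y : ℝ}, y ∈ Set.Ioo (0 : ℝ) 1 → 0 < betaSurvival a b y ^ α := fun hy =>
    Real.rpow_pos_of_pos (betaSurvival_pos ha hb (Set.Ioo_subset_Ico_self hy)) α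
  refine ⟨hG, strictAntiOn_betaSurvival ha hb, hz, ?_, ?_⟩
  · refine strictMonoOn_of_deriv_pos (convex_Icc 0 z) (hG.continuous_jumpProfit hα).continuousOn
      fun y hy => ?_
    rw [interior_Icc] at hy
    have hy1 : y ∈ Set.Ioo (0 : ℝ) 1 := ⟨hy.1, hy.2.trans hz.2⟩
    rw [(hasDerivAt_jumpProfit_betaSurvival ha hb hy1).deriv]
    exact mul_pos (hpow hy1) (jumpMargin_pos_of_lt ha hb hy.1 hy.2 hz.2 hz0.ge)
  · refine strictAntiOn_of_deriv_neg (convex_Icc z 1) (hG.continuous_jumpProfit hα).continuousOn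
      fun y hy => ?_
    rw [interior_Icc] at hy
    have hy1 : y ∈ Set.Ioo (0 : ℝ) 1 := ⟨hz.1.trans hy.1, hy.2⟩
    rw [(hasDerivAt_jumpProfit_betaSurvival ha hb hy1).deriv]
    refine mul_neg_of_pos_of_neg (hpow hy1) (lt_of_not_ge fun h => ?_)
    exact (jumpMargin_pos_of_lt ha hb hz.1 hy.1 hy.2 h).ne' hz0

lemma exists_hasPeak_betaSurvival (ha : 0 < a) (hb : 0 < b) (hα : 0 < α) :
    ∃ z, HasPeak α (betaSurvival a b) z ∧ jumpMargin a b α z = 0 := by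
  obtain ⟨z, hz, hz0⟩ := exists_jumpMargin_eq_zero ha hb hα
  exact ⟨z, hasPeak_of_jumpMargin_eq_zero ha hb hα hz hz0, hz0⟩

end BetaPeak

/-! ### Comparison of symmetric Beta laws -/

section SymmetricBetaLaw

variable {a b c : ℝ}

lemma betaPDFReal_self_one_sub (a x : ℝ) : betaPDFReal a a (1 - x) = betaPDFReal a a x := by
  by_cases hx : x ∈ Set.Ioo (0 : ℝ) 1
  · rw [betaPDFReal_eq_of_mem_Ioo hx,
      betaPDFReal_eq_of_mem_Ioo ⟨sub_pos.2 hx.2, sub_lt_self 1 hx.1⟩, sub_sub_cancel,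
      mul_comm ((1 - x) ^ _)]
  · have hx' : 1 - x ∉ Set.Ioo (0 : ℝ) 1 := fun h =>
      hx ⟨by linarith [h.2], by linarith [h.1]⟩
    rw [betaPDFReal_eq_zero_of_notMem_Ioo hx, betaPDFReal_eq_zero_of_notMem_Ioo hx']

lemma betaSurvival_self_one_sub (ha : 0 < a) (y : ℝ) :
    betaSurvival a a (1 - y) = 1 - betaSurvival a a y := by
  have h := betaSurvival_sub ha ha (1 - y) (1 - 0)
  rw [← intervalIntegral.integral_comp_sub_left] at h
  simp only [betaPDFReal_self_one_sub] at h
  rwa [← betaSurvival_sub ha ha, sub_zero, betaSurvival_of_one_le a a le_rfl, sub_zero,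
    betaSurvival_of_nonpos ha ha le_rfl] at h

lemma betaSurvival_self_half (ha : 0 < a) : betaSurvival a a (1 / 2) = 1 / 2 := by
  have h := betaSurvival_self_one_sub ha (1 / 2)
  rw [sub_half] at h
  linarith

lemma betaPDFReal_self_eq_mul_rpow (hb : 0 < b) (a : ℝ) {x : ℝ} (hx : x ∈ Set.Ioo (0 : ℝ) 1) :
    betaPDFReal a a x
      = beta b b / beta a a * betaPDFReal b b x * (x * (1 - x)) ^ (a - b) := by
  have := (beta_pos hb hb).ne'
  have hpow : ∀ {u : ℝ}, 0 < u → u ^ (a - 1) = u ^ (b - 1) * u ^ (a - b) := fun {u} hu => by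
    rw [← Real.rpow_add hu]
    congr 1
    ring
  rw [betaPDFReal_eq_of_mem_Ioo hx, betaPDFReal_eq_of_mem_Ioo hx,
    Real.mul_rpow hx.1.le (sub_nonneg.2 hx.2.le), hpow hx.1, hpow (sub_pos.2 hx.2)]
  field_simp

lemma betaPDFReal_self_mul_lt (hb : 0 < b) (hba : b < a) {x y : ℝ} (hx : 1 / 2 ≤ x)
    (hxy : x < y) (hy : y < 1) :
    betaPDFReal b b x * betaPDFReal a a y < betaPDFReal b b y * betaPDFReal a a x := by
  have ha : 0 < a := hb.trans hba
  have hx01 : x ∈ Set.Ioo (0 : ℝ) 1 := ⟨by linarith, hxy.trans hy⟩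
  have hy01 : y ∈ Set.Ioo (0 : ℝ) 1 := ⟨hx01.1.trans hxy, hy⟩
  have hvar : y * (1 - y) < x * (1 - x) := by nlinarith
  have hrpow : (y * (1 - y)) ^ (a - b) < (x * (1 - x)) ^ (a - b) :=
    Real.rpow_lt_rpow (mul_pos hy01.1 (sub_pos.2 hy)).le hvar (sub_pos.2 hba)
  have hcoef : 0 < beta b b / beta a a * betaPDFReal b b x * betaPDFReal b b y :=
    mul_pos (mul_pos (div_pos (beta_pos hb hb) (beta_pos ha ha))
      (betaPDFReal_pos hx01.1 hx01.2 hb hb)) (betaPDFReal_pos hy01.1 hy hb hb)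
  rw [betaPDFReal_self_eq_mul_rpow hb a hx01, betaPDFReal_self_eq_mul_rpow hb a hy01]
  linarith [mul_lt_mul_of_pos_left hrpow hcoef]

lemma betaPDFReal_self_mul_betaSurvival_lt (hb : 0 < b) (hba : b < a) {x : ℝ} (hx : 1 / 2 ≤ x)
    (hx1 : x < 1) :
    betaPDFReal b b x * betaSurvival a a x < betaPDFReal a a x * betaSurvival b b x := by
  have ha : 0 < a := hb.trans hba
  have hfa := (integrable_betaPDFReal ha ha).intervalIntegrable (a := x) (b := 1)
  have hfb := (integrable_betaPDFReal hb hb).intervalIntegrable (a := x) (b := 1)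
  have hpos := intervalIntegral.intervalIntegral_pos_of_pos_on
    ((hfb.const_mul (betaPDFReal a a x)).sub (hfa.const_mul (betaPDFReal b b x)))
    (fun t ht => by linarith [betaPDFReal_self_mul_lt hb hba hx ht.1 ht.2]) hx1
  rw [intervalIntegral.integral_sub (hfb.const_mul _) (hfa.const_mul _),
    intervalIntegral.integral_const_mul, intervalIntegral.integral_const_mul,
    ← betaSurvival_sub hb hb, ← betaSurvival_sub ha ha, betaSurvival_of_one_le b b le_rfl,
    betaSurvival_of_one_le a a le_rfl, sub_zero, sub_zero] at hpos
  exact sub_pos.1 hpos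

lemma betaPDFReal_self_half_lt (hb : 0 < b) (hba : b < a) :
    betaPDFReal b b (1 / 2) < betaPDFReal a a (1 / 2) := by
  have h := betaPDFReal_self_mul_betaSurvival_lt hb hba le_rfl one_half_lt_one
  rw [betaSurvival_self_half hb, betaSurvival_self_half (hb.trans hba)] at h
  exact lt_of_mul_lt_mul_right h one_half_pos.le

lemma strictAntiOn_betaSurvival_self_div (hb : 0 < b) (hba : b < a) :
    StrictAntiOn (fun y => betaSurvival a a y / betaSurvival b b y) (Set.Ico (1 / 2) 1) := by
  have ha : 0 < a := hb.trans hba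
  have hGb : ∀ {y : ℝ}, y ∈ Set.Ico (1 / 2 : ℝ) 1 → 0 < betaSurvival b b y := fun hy =>
    betaSurvival_pos hb hb ⟨one_half_pos.le.trans hy.1, hy.2⟩
  refine strictAntiOn_of_deriv_neg (convex_Ico _ _)
    ((isSurvival_betaSurvival ha ha).continuous.continuousOn.div
      (isSurvival_betaSurvival hb hb).continuous.continuousOn fun y hy => (hGb hy).ne')
    fun y hy => ?_
  rw [interior_Ico] at hy
  have hy01 : y ∈ Set.Ioo (0 : ℝ) 1 := ⟨one_half_pos.trans hy.1, hy.2⟩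
  have hGy := hGb (Set.Ioo_subset_Ico_self hy)
  rw [deriv_fun_div (hasDerivAt_betaSurvival ha ha hy01).differentiableAt
    (hasDerivAt_betaSurvival hb hb hy01).differentiableAt hGy.ne',
    (hasDerivAt_betaSurvival ha ha hy01).deriv, (hasDerivAt_betaSurvival hb hb hy01).deriv]
  refine div_neg_of_neg_of_pos ?_ (pow_pos hGy 2)
  linarith [betaPDFReal_self_mul_betaSurvival_lt hb hba hy.1.le hy.2]

lemma betaSurvival_self_lt_of_half_lt (hb : 0 < b) (hba : b < a) {z : ℝ} (hz : 1 / 2 < z)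
    (hz1 : z < 1) : betaSurvival a a z < betaSurvival b b z := by
  have h := strictAntiOn_betaSurvival_self_div hb hba ⟨le_rfl, one_half_lt_one⟩ ⟨hz.le, hz1⟩ hz
  simp only [betaSurvival_self_half hb, betaSurvival_self_half (hb.trans hba)] at h
  rwa [div_self (by norm_num), div_lt_one (betaSurvival_pos hb hb ⟨by linarith, hz1⟩)] at h

lemma betaSurvival_self_lt_of_lt_half (hb : 0 < b) (hba : b < a) {y : ℝ} (hy0 : 0 < y)
    (hy : y < 1 / 2) : betaSurvival b b y < betaSurvival a a y := by
  have h := betaSurvival_self_lt_of_half_lt hb hba (z := 1 - y) (by linarith) (by linarith)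
  rw [betaSurvival_self_one_sub hb, betaSurvival_self_one_sub (hb.trans hba)] at h
  linarith

lemma betaSurvival_self_le_of_half_le (hb : 0 < b) (hba : b < a) {z : ℝ} (hz : 1 / 2 ≤ z)
    (hz1 : z < 1) : betaSurvival a a z ≤ betaSurvival b b z := by
  rcases hz.eq_or_lt with rfl | hz
  · rw [betaSurvival_self_half hb, betaSurvival_self_half (hb.trans hba)]
  · exact (betaSurvival_self_lt_of_half_lt hb hba hz hz1).le

lemma betaSurvival_self_mul_le (hb : 0 < b) (hba : b < a) {u z : ℝ} (hu : 0 < u) (huz : u ≤ z)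
    (hz : 1 / 2 ≤ z) (hz1 : z < 1) :
    betaSurvival b b u * betaSurvival a a z ≤ betaSurvival b b z * betaSurvival a a u := by
  have ha : 0 < a := hb.trans hba
  rcases le_or_gt (1 / 2) u with huh | huh
  · have hdiv := (strictAntiOn_betaSurvival_self_div hb hba).antitoneOn ⟨huh, huz.trans_lt hz1⟩
      ⟨hz, hz1⟩ huz
    have hle := (div_le_div_iff₀ (betaSurvival_pos hb hb ⟨by linarith, hz1⟩)
      (betaSurvival_pos hb hb ⟨hu.le, huz.trans_lt hz1⟩)).1 hdiv
    linarith
  · rw [mul_comm (betaSurvival b b z)]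
    exact mul_le_mul (betaSurvival_self_lt_of_lt_half hb hba hu huh).le
      (betaSurvival_self_le_of_half_le hb hba hz hz1)
      ((isSurvival_betaSurvival ha ha).nonneg z) ((isSurvival_betaSurvival ha ha).nonneg u)

lemma strictConvexOn_affine_add_rpow (A : ℝ) {B k : ℝ} (hB : 0 < B) (hk : 1 < k) :
    StrictConvexOn ℝ (Set.Ici 0) fun v : ℝ => 1 - A * v + B * v ^ k := by
  refine ⟨convex_Ici 0, fun x hx y hy hxy s t hs ht hst => ?_⟩
  have hpow := mul_lt_mul_of_pos_left ((strictConvexOn_rpow hk).2 hx hy hxy hs ht hst) hB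
  simp only [smul_eq_mul] at hpow ⊢
  linear_combination hpow - hst

lemma betaPDFReal_self_combination_eq (hb : 0 < b) (hba : b < a) (c r : ℝ) {x : ℝ}
    (hx : x ∈ Set.Ioo (0 : ℝ) 1) :
    betaPDFReal b b x - (1 + r) * betaPDFReal a a x + r * betaPDFReal c c x
      = betaPDFReal b b x * (1 - (1 + r) * (beta b b / beta a a) * (x * (1 - x)) ^ (a - b)
        + r * (beta b b / beta c c) * ((x * (1 - x)) ^ (a - b)) ^ ((c - b) / (a - b))) := by
  rw [← Real.rpow_mul (mul_pos hx.1 (sub_pos.2 hx.2)).le,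
    mul_div_cancel₀ _ (sub_pos.2 hba).ne', betaPDFReal_self_eq_mul_rpow hb a hx,
    betaPDFReal_self_eq_mul_rpow hb c hx]
  ring

lemma betaPDFReal_self_combination_neg {r : ℝ} (hb : 0 < b) (hba : b < a) (hac : a < c)
    (hr : 0 < r) {x y z : ℝ} (hx : 0 < x) (hxy : x < y) (hyz : y < z) (hz : z < 1 / 2)
    (hfx : betaPDFReal b b x - (1 + r) * betaPDFReal a a x + r * betaPDFReal c c x ≤ 0)
    (hfz : betaPDFReal b b z - (1 + r) * betaPDFReal a a z + r * betaPDFReal c c z ≤ 0) :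
    betaPDFReal b b y - (1 + r) * betaPDFReal a a y + r * betaPDFReal c c y < 0 := by
  have hc : 0 < c := hb.trans (hba.trans hac)
  have hab : 0 < a - b := sub_pos.2 hba
  have hconv := strictConvexOn_affine_add_rpow ((1 + r) * (beta b b / beta a a))
    (mul_pos hr (div_pos (beta_pos hb hb) (beta_pos hc hc)))
    ((one_lt_div hab).2 (by linarith) : 1 < (c - b) / (a - b))
  have hvar : ∀ {t : ℝ}, t ∈ Set.Ioo (0 : ℝ) (1 / 2) → 0 < t * (1 - t) := fun ht =>
    mul_pos ht.1 (by linarith [ht.2])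
  have hmono : StrictMonoOn (fun t : ℝ => (t * (1 - t)) ^ (a - b)) (Set.Ioo 0 (1 / 2)) :=
    fun s hs t ht hst => Real.rpow_lt_rpow (hvar hs).le (by nlinarith [ht.2]) hab
  have hfpos : ∀ {t : ℝ}, t ∈ Set.Ioo (0 : ℝ) (1 / 2) → 0 < betaPDFReal b b t := fun ht =>
    betaPDFReal_pos ht.1 (by linarith [ht.2]) hb hb
  have h01 : Set.Ioo (0 : ℝ) (1 / 2) ⊆ Set.Ioo 0 1 :=
    Set.Ioo_subset_Ioo_right one_half_lt_one.le
  have hx' : x ∈ Set.Ioo (0 : ℝ) (1 / 2) := ⟨hx, hxy.trans (hyz.trans hz)⟩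
  have hy' : y ∈ Set.Ioo (0 : ℝ) (1 / 2) := ⟨hx.trans hxy, hyz.trans hz⟩
  have hz' : z ∈ Set.Ioo (0 : ℝ) (1 / 2) := ⟨hy'.1.trans hyz, hz⟩
  have hvxy := hmono hx' hy' hxy
  have hvyz := hmono hy' hz' hyz
  rw [betaPDFReal_self_combination_eq hb hba c r (h01 hx')] at hfx
  rw [betaPDFReal_self_combination_eq hb hba c r (h01 hz')] at hfz
  rw [betaPDFReal_self_combination_eq hb hba c r (h01 hy')]
  refine mul_neg_of_pos_of_neg (hfpos hy') ((hconv.lt_on_openSegment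
    (Real.rpow_nonneg (hvar hx').le _) (Real.rpow_nonneg (hvar hz').le _) (hvxy.trans hvyz).ne
    (openSegment_eq_Ioo (hvxy.trans hvyz) ▸ ⟨hvxy, hvyz⟩)).trans_le ?_)
  exact max_le (nonpos_of_mul_nonpos_right hfx (hfpos hx'))
    (nonpos_of_mul_nonpos_right hfz (hfpos hz'))

lemma nonpos_and_pos_of_eq_zero_of_hasDerivAt {h h' : ℝ → ℝ} {p w q : ℝ} (hw : w ∈ Set.Ioo p q)
    (hcont : ContinuousOn h (Set.Icc p q)) (hderiv : ∀ x ∈ Set.Ioo p q, HasDerivAt h (h' x) x)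
    (hp0 : h p = 0) (hw0 : h w = 0) (hq0 : h q = 0)
    (hsign : ∀ x y z, p < x → x < y → y < z → z < q → 0 ≤ h' x → 0 ≤ h' z → 0 < h' y) :
    (∀ y ∈ Set.Ioo p w, h y ≤ 0) ∧ ∀ y ∈ Set.Ioo w q, 0 < h y := by
  have hslope : ∀ s t, p ≤ s → s < t → t ≤ q →
      ∃ x ∈ Set.Ioo s t, h' x = (h t - h s) / (t - s) := fun s t hs hst ht =>
    exists_hasDerivAt_eq_slope h h' hst (hcont.mono (Set.Icc_subset_Icc hs ht))
      fun x hx => hderiv x (Set.Ioo_subset_Ioo hs ht hx)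
  refine ⟨fun y hy => ?_, fun y hy => ?_⟩
  · by_contra! hpos
    obtain ⟨x₁, hx₁, he₁⟩ := hslope p y le_rfl hy.1 (hy.2.trans hw.2).le
    obtain ⟨x₂, hx₂, he₂⟩ := hslope y w hy.1.le hy.2 hw.2.le
    obtain ⟨x₃, hx₃, he₃⟩ := hslope w q hw.1.le hw.2 le_rfl
    refine (hsign x₁ x₂ x₃ hx₁.1 (hx₁.2.trans hx₂.1) (hx₂.2.trans hx₃.1) hx₃.2 ?_ ?_).not_ge ?_
    · exact he₁ ▸ div_nonneg (by linarith) (sub_nonneg.2 hy.1.le)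
    · exact he₃ ▸ div_nonneg (by linarith) (sub_nonneg.2 hw.2.le)
    · exact he₂ ▸ div_nonpos_of_nonpos_of_nonneg (by linarith) (sub_nonneg.2 hy.2.le)
  · by_contra! hneg
    obtain ⟨x₁, hx₁, he₁⟩ := hslope p w le_rfl hw.1 hw.2.le
    obtain ⟨x₂, hx₂, he₂⟩ := hslope w y hw.1.le hy.1 hy.2.le
    obtain ⟨x₃, hx₃, he₃⟩ := hslope y q (hw.1.trans hy.1).le hy.2 le_rfl
    refine (hsign x₁ x₂ x₃ hx₁.1 (hx₁.2.trans hx₂.1) (hx₂.2.trans hx₃.1) hx₃.2 ?_ ?_).not_ge ?_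
    · exact he₁ ▸ div_nonneg (by linarith) (sub_nonneg.2 hw.1.le)
    · exact he₃ ▸ div_nonneg (by linarith) (sub_nonneg.2 hy.2.le)
    · exact he₂ ▸ div_nonpos_of_nonpos_of_nonneg (by linarith) (sub_nonneg.2 hy.1.le)

lemma exists_betaSurvival_self_combination (hb : 0 < b) (hba : b < a) (hac : a < c) {w : ℝ}
    (hw : w ∈ Set.Ioo (0 : ℝ) (1 / 2)) :
    ∃ r > 0, (∀ y ∈ Set.Ioo 0 w,
        betaSurvival b b y + r * betaSurvival c c y ≤ (1 + r) * betaSurvival a a y) ∧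
      ∀ y ∈ Set.Ioo w (1 / 2),
        (1 + r) * betaSurvival a a y < betaSurvival b b y + r * betaSurvival c c y := by
  have ha : 0 < a := hb.trans hba
  have hc : 0 < c := ha.trans hac
  have hab := sub_pos.2 (betaSurvival_self_lt_of_lt_half hb hba hw.1 hw.2)
  have hca := sub_pos.2 (betaSurvival_self_lt_of_lt_half ha hac hw.1 hw.2)
  obtain ⟨r, hr⟩ : ∃ r, r = (betaSurvival a a w - betaSurvival b b w) /
    (betaSurvival c c w - betaSurvival a a w) := ⟨_, rfl⟩
  have hr0 : 0 < r := hr ▸ div_pos hab hca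
  rw [eq_div_iff hca.ne'] at hr
  have hcont : Continuous fun y =>
      betaSurvival b b y - (1 + r) * betaSurvival a a y + r * betaSurvival c c y :=
    ((isSurvival_betaSurvival hb hb).continuous.sub
      ((isSurvival_betaSurvival ha ha).continuous.const_mul _)).add
      ((isSurvival_betaSurvival hc hc).continuous.const_mul _)
  have hderiv : ∀ y ∈ Set.Ioo (0 : ℝ) (1 / 2), HasDerivAt (fun y =>
      betaSurvival b b y - (1 + r) * betaSurvival a a y + r * betaSurvival c c y)
      (-(betaPDFReal b b y - (1 + r) * betaPDFReal a a y + r * betaPDFReal c c y)) y :=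
    fun y hy => by
      have hy1 : y ∈ Set.Ioo (0 : ℝ) 1 := ⟨hy.1, by linarith [hy.2]⟩
      refine (((hasDerivAt_betaSurvival hb hb hy1).sub
        ((hasDerivAt_betaSurvival ha ha hy1).const_mul _)).add
        ((hasDerivAt_betaSurvival hc hc hy1).const_mul _)).congr_deriv ?_
      ring
  obtain ⟨hle, hlt⟩ := nonpos_and_pos_of_eq_zero_of_hasDerivAt hw hcont.continuousOn hderiv
    (by simp only [betaSurvival_of_nonpos, ha, hb, hc, le_rfl]; ring) (by linarith)
    (by simp only [betaSurvival_self_half, ha, hb, hc]; ring)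
    fun x y z hx hxy hyz hz hfx hfz => neg_pos.2 <|
      betaPDFReal_self_combination_neg hb hba hac hr0 hx hxy hyz hz (neg_nonneg.1 hfx)
        (neg_nonneg.1 hfz)
  exact ⟨r, hr0, fun y hy => by linarith [hle y hy], fun y hy => by linarith [hlt y hy]⟩

end SymmetricBetaLaw

/-! ### Optimal values for symmetric Beta laws -/

section PeakPosition

variable {a b α z : ℝ}

lemma lt_of_jumpMargin_pos (ha : 0 < a) (hb : 0 < b) (hz : 0 < z)
    (hz0 : jumpMargin a b α z = 0) {y : ℝ} (hy : y < 1) (hpos : 0 < jumpMargin a b α y) :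
    y < z := by
  by_contra! hzy
  rcases hzy.eq_or_lt with rfl | hzy
  · exact hpos.ne' hz0
  · exact (jumpMargin_pos_of_lt ha hb hz hzy hy hpos.le).ne' hz0

lemma jumpMargin_nonneg_of_le (ha : 0 < a) (hb : 0 < b) (hz : z < 1)
    (hz0 : jumpMargin a b α z = 0) {y : ℝ} (hy : 0 < y) (hyz : y ≤ z) :
    0 ≤ jumpMargin a b α y := by
  rcases hyz.eq_or_lt with rfl | hyz
  · exact hz0.ge
  · exact (jumpMargin_pos_of_lt ha hb hy hyz hz hz0.ge).le

lemma jumpMargin_self_half (ha : 0 < a) (α : ℝ) :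
    jumpMargin a a α (1 / 2) = (1 - (1 + α) * betaPDFReal a a (1 / 2)) / 2 := by
  rw [jumpMargin, betaSurvival_self_half ha]
  ring

lemma jumpMargin_self_half_lt (hb : 0 < b) (hba : b < a) (hα : 0 < α) :
    jumpMargin a a α (1 / 2) < jumpMargin b b α (1 / 2) := by
  rw [jumpMargin_self_half hb, jumpMargin_self_half (hb.trans hba)]
  have := mul_lt_mul_of_pos_left (betaPDFReal_self_half_lt hb hba) (by linarith : 0 < 1 + α)
  linarith

lemma betaPDFReal_self_half_le (ha : 0 < a) (ha1 : a ≤ 1) :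
    betaPDFReal a a (1 / 2) ≤ 2 * a := by
  have hB : 0 ≤ (beta a a)⁻¹ := (inv_pos.2 (beta_pos ha ha)).le
  have hmass : (beta a a)⁻¹ * ((1 / 2) ^ a / a) ≤ 1 / 2 := by
    have hint : ∫ x in (0 : ℝ)..1 / 2, (beta a a)⁻¹ * x ^ (a - 1)
        = (beta a a)⁻¹ * ((1 / 2) ^ a / a) := by
      rw [intervalIntegral.integral_const_mul, integral_rpow (Or.inl (by linarith)),
        sub_add_cancel, Real.zero_rpow ha.ne', sub_zero]
    have hhalf : ∫ x in (0 : ℝ)..1 / 2, betaPDFReal a a x = 1 / 2 := by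
      rw [← betaSurvival_sub ha ha, betaSurvival_of_nonpos ha ha le_rfl,
        betaSurvival_self_half ha, sub_half]
    refine (hint.symm.trans_le ?_).trans_eq hhalf
    refine intervalIntegral.integral_mono_on_of_le_Ioo one_half_pos.le
      ((intervalIntegral.intervalIntegrable_rpow' (by linarith)).const_mul _)
      (integrable_betaPDFReal ha ha).intervalIntegrable fun x hx => ?_
    rw [betaPDFReal_eq_of_mem_Ioo (Set.Ioo_subset_Ioo_right one_half_lt_one.le hx)]
    refine mul_le_mul_of_nonneg_left (le_mul_of_one_le_right (Real.rpow_nonneg hx.1.le _)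
      (Real.one_le_rpow_of_pos_of_le_one_of_nonpos ?_ ?_ ?_)) hB <;> linarith [hx.1, hx.2]
  have hhalf1 : ((1 : ℝ) / 2) ^ a ≤ 1 :=
    Real.rpow_le_one one_half_pos.le one_half_lt_one.le ha.le
  calc betaPDFReal a a (1 / 2)
      = 4 * a * ((beta a a)⁻¹ * ((1 / 2) ^ a / a)) * (1 / 2) ^ a := by
        rw [betaPDFReal_eq_of_mem_Ioo ⟨one_half_pos, one_half_lt_one⟩, sub_half,
          Real.rpow_sub_one (by norm_num)]
        field_simp
        ring
    _ ≤ 4 * a * (1 / 2) * 1 := by gcongr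
    _ = 2 * a := by ring

end PeakPosition

section Concentration

lemma one_sub_variance_div_sq_le_survival {μ : Measure ℝ} [IsProbabilityMeasure μ]
    (hμ : MemLp id 2 μ) {y : ℝ} (hy : y < ∫ x, x ∂μ) :
    1 - variance id μ / (∫ x, x ∂μ - y) ^ 2 ≤ survival μ y := by
  have hcompl : survival μ y = 1 - μ.real (Set.Iio y) := by
    rw [survival, ← Set.compl_Iio, probReal_compl_eq_one_sub measurableSet_Iio]
  have hsub : Set.Iio y ⊆ {x | ∫ x, x ∂μ - y ≤ |id x - ∫ x, id x ∂μ|} := fun x hx => by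
    rw [Set.mem_ofPred_eq, abs_sub_comm]
    exact (sub_le_sub_left (le_of_lt hx) _).trans (le_abs_self _)
  rw [hcompl]
  refine sub_le_sub_left ((measureReal_mono hsub).trans (ENNReal.toReal_le_of_le_ofReal ?_
    (meas_ge_le_variance_div_sq hμ (sub_pos.2 hy)))) 1
  exact div_nonneg (variance_nonneg _ _) (sq_nonneg _)

lemma integral_id_betaMeasure_self {a : ℝ} (ha : 0 < a) :
    ∫ x, x ∂betaMeasure a a = 1 / 2 := by
  rw [integral_id_betaMeasure ha ha]
  field_simp
  ring

lemma variance_id_betaMeasure_self {a : ℝ} (ha : 0 < a) :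
    variance id (betaMeasure a a) = 1 / (4 * (2 * a + 1)) := by
  rw [variance_id_betaMeasure ha ha]
  field_simp
  ring

lemma tendsto_betaSurvival_self_atTop {y : ℝ} (hy : y < 1 / 2) :
    Filter.Tendsto (fun a => betaSurvival a a y) Filter.atTop (nhds 1) := by
  have hbound : Filter.Tendsto (fun a : ℝ => 1 - 1 / (4 * (2 * a + 1)) / (1 / 2 - y) ^ 2)
      Filter.atTop (nhds (1 - 0 / (1 / 2 - y) ^ 2)) :=
    tendsto_const_nhds.sub <| Filter.Tendsto.div_const (Filter.Tendsto.const_div_atTop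
      ((Filter.tendsto_atTop_add_const_right _ _
        (Filter.tendsto_id.const_mul_atTop two_pos)).const_mul_atTop four_pos) 1) _
  rw [zero_div, sub_zero] at hbound
  refine tendsto_of_tendsto_of_tendsto_of_le_of_le' hbound tendsto_const_nhds ?_ ?_
  all_goals filter_upwards [Filter.eventually_gt_atTop 0] with a ha
  · have := isProbabilityMeasureBeta ha ha
    have h := one_sub_variance_div_sq_le_survival (memLp_id_betaMeasure ha ha 2)
      (hy.trans_eq (integral_id_betaMeasure_self ha).symm)
    rwa [variance_id_betaMeasure_self ha, integral_id_betaMeasure_self ha] at h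
  · exact (isSurvival_betaSurvival ha ha).le_one y

end Concentration

/-- The optimal value for the income law `Beta(a, a)` and a demand of constant elasticity `α`. -/
noncomputable abbrev symmBetaValue (ρ α a : ℝ) : ℝ :=
  optValue ρ (constElasticityDemand α) (betaSurvival a a) 0

namespace StationaryLoan

variable {ρ α δ K : ℝ}

lemma optValue_survival_le (hS : StationaryLoan ρ α δ K) {μ : Measure ℝ} [IsFiniteMeasure μ]
    (hG : IsSurvival (survival μ)) (hμ : Integrable id μ) :
    optValue ρ (constElasticityDemand α) (survival μ) 0 ≤ K * ∫ x in Set.Ici 0, x ∂μ := by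
  refine hS.optValue_zero_le (T := fun m => ∫ x in Set.Ici m, x ∂μ) hG
    (fun x hx y _ hxy => ?_) fun y _ => ?_
  · refine setIntegral_mono_set hμ.integrableOn ?_ (Set.Ici_subset_Ici.2 hxy).eventuallyLE
    filter_upwards [ae_restrict_mem measurableSet_Ici] with t ht
    exact (Set.mem_Ici.1 hx).trans ht
  · have h := setIntegral_mono_on (μ := μ) (f := fun _ => y)
      (integrableOn_const (measure_ne_top _ _)) hμ.integrableOn measurableSet_Ici fun x hx => hx
    rwa [setIntegral_const, smul_eq_mul, mul_comm] at h

lemma symmBetaValue_le (hS : StationaryLoan ρ α δ K) {a : ℝ} (ha : 0 < a) :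
    symmBetaValue ρ α a ≤ K / 2 := by
  have := isProbabilityMeasureBeta ha ha
  have hnonneg : ∀ᵐ x ∂betaMeasure a a, x ∈ Set.Ici (0 : ℝ) := by
    filter_upwards [ae_mem_Ioo_betaMeasure a a] with x hx using hx.1.le
  have h := hS.optValue_survival_le (isSurvival_betaSurvival ha ha)
    ((memLp_id_betaMeasure ha ha 1).integrable le_rfl)
  rwa [Measure.restrict_eq_self_of_ae_mem hnonneg, integral_id_betaMeasure_self ha,
    mul_one_div] at h

variable {a b c z : ℝ}

lemma exists_betaSurvival_mul_symmBetaValue_le (hS : StationaryLoan ρ α δ K) (hb : 0 < b)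
    (hba : b < a) (h : HasPeak α (betaSurvival a a) z) (hz : 1 / 2 ≤ z) :
    ∃ e ≥ 0, betaSurvival b b z * (symmBetaValue ρ α a + e)
      ≤ betaSurvival a a z * (symmBetaValue ρ α b + e) := by
  have hz1 := h.peak_mem.2
  obtain ⟨m₁, hm₁, C, hC, P, -, e, he, hVa, hV⟩ := hS.exists_affine_le_optValue h
  refine ⟨e, he, ?_⟩
  have hloss : betaSurvival a a z * C (betaSurvival b b)
      ≤ betaSurvival b b z * C (betaSurvival a a) := by
    rw [← smul_eq_mul, ← smul_eq_mul, ← map_smul, ← map_smul]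
    refine apply_le_apply_of_mem_screeningLosses hC fun y hy => ?_
    rw [Pi.smul_apply, smul_eq_mul, mul_comm]
    exact betaSurvival_self_mul_le hb hba hy.1 (hy.2.trans hm₁.2).le hz hz1
  have hVb := mul_le_mul_of_nonneg_left (hV _ (isSurvival_betaSurvival hb hb)) (h.nonneg z)
  rw [symmBetaValue, hVa]
  linarith

lemma symmBetaValue_le_of_half_le_peak (hS : StationaryLoan ρ α δ K) (hb : 0 < b) (hba : b < a)
    (h : HasPeak α (betaSurvival a a) z) (hz : 1 / 2 ≤ z) :
    symmBetaValue ρ α a ≤ symmBetaValue ρ α b := by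
  have hpos : 0 < symmBetaValue ρ α a := hS.optValue_pos h le_rfl zero_lt_one
  obtain ⟨e, he, hle⟩ := hS.exists_betaSurvival_mul_symmBetaValue_le hb hba h hz
  have hG := mul_le_mul_of_nonneg_right
    (betaSurvival_self_le_of_half_le hb hba hz h.peak_mem.2) (add_nonneg hpos.le he)
  exact le_of_add_le_add_right (le_of_mul_le_mul_left (hG.trans hle) (h.pos h.peak_mem.2))

lemma symmBetaValue_lt_of_half_lt_peak (hS : StationaryLoan ρ α δ K) (hb : 0 < b) (hba : b < a)
    (h : HasPeak α (betaSurvival a a) z) (hz : 1 / 2 < z) :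
    symmBetaValue ρ α a < symmBetaValue ρ α b := by
  have hpos : 0 < symmBetaValue ρ α a := hS.optValue_pos h le_rfl zero_lt_one
  obtain ⟨e, he, hle⟩ := hS.exists_betaSurvival_mul_symmBetaValue_le hb hba h hz.le
  have hG := mul_lt_mul_of_pos_right
    (betaSurvival_self_lt_of_half_lt hb hba hz h.peak_mem.2) (add_pos_of_pos_of_nonneg hpos he)
  exact lt_of_add_lt_add_right (lt_of_mul_lt_mul_left (hG.trans_le hle) (h.nonneg z))

lemma symmBetaValue_lt_of_jumpMargin_half_pos (hS : StationaryLoan ρ α δ K)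
    (hb : 0 < b) (hba : b < a) (hmargin : 0 < jumpMargin a a α (1 / 2)) :
    symmBetaValue ρ α a < symmBetaValue ρ α b := by
  have ha : 0 < a := hb.trans hba
  obtain ⟨z, h, hz0⟩ := exists_hasPeak_betaSurvival ha ha hS.alpha_pos
  exact hS.symmBetaValue_lt_of_half_lt_peak hb hba h
    (lt_of_jumpMargin_pos ha ha h.peak_mem.1 hz0 one_half_lt_one hmargin)

/- If the peak sits exactly at the mean, the comparison with `b` is only weak; it becomes strict
through an intermediate law, whose peak lies strictly above the mean. -/
lemma symmBetaValue_lt_of_jumpMargin_half_nonneg (hS : StationaryLoan ρ α δ K)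
    (hb : 0 < b) (hba : b < a) (h : HasPeak α (betaSurvival a a) z) (hz : 1 / 2 ≤ z)
    (hmargin : 0 ≤ jumpMargin a a α (1 / 2)) :
    symmBetaValue ρ α a < symmBetaValue ρ α b := by
  obtain ⟨c, hbc, hca⟩ := exists_between hba
  have hc : 0 < c := hb.trans hbc
  exact (hS.symmBetaValue_le_of_half_le_peak hc hca h hz).trans_lt
    (hS.symmBetaValue_lt_of_jumpMargin_half_pos hb hbc
      (hmargin.trans_lt (jumpMargin_self_half_lt hc hca hS.alpha_pos)))

lemma symmBetaValue_lt_max_of_peak_lt_half (hS : StationaryLoan ρ α δ K) (hb : 0 < b)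
    (hba : b < a) (hac : a < c) (h : HasPeak α (betaSurvival a a) z) (hz : z < 1 / 2) :
    symmBetaValue ρ α a < max (symmBetaValue ρ α b) (symmBetaValue ρ α c) := by
  have hc : 0 < c := hb.trans (hba.trans hac)
  obtain ⟨m₁, hm₁, C, hC, P, hP, e, -, hVa, hV⟩ := hS.exists_affine_le_optValue h
  have hVb := hV _ (isSurvival_betaSurvival hb hb)
  have hVc := hV _ (isSurvival_betaSurvival hc hc)
  obtain ⟨r, hr, hle, hlt⟩ :=
    exists_betaSurvival_self_combination hb hba hac ⟨hm₁.1, hm₁.2.trans hz⟩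
  have hloss : C (betaSurvival b b) + r * C (betaSurvival c c)
      ≤ (1 + r) * C (betaSurvival a a) := by
    rw [← smul_eq_mul, ← smul_eq_mul, ← map_smul, ← map_smul, ← map_add]
    exact apply_le_apply_of_mem_screeningLosses hC hle
  have hjump := mul_lt_mul_of_pos_left (hlt z ⟨hm₁.2, hz⟩) hP
  have hsum : (1 + r) * symmBetaValue ρ α a
      < symmBetaValue ρ α b + r * symmBetaValue ρ α c := by
    rw [symmBetaValue, hVa]
    linarith [mul_le_mul_of_nonneg_left hVc hr.le]
  rw [lt_max_iff]
  by_contra! hcon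
  linarith [hcon.1, mul_le_mul_of_nonneg_left hcon.2 hr.le]

lemma symmBetaValue_lt_max (hS : StationaryLoan ρ α δ K) (hb : 0 < b)
    (hba : b < a) (hac : a < c) :
    symmBetaValue ρ α a < max (symmBetaValue ρ α b) (symmBetaValue ρ α c) := by
  have ha : 0 < a := hb.trans hba
  obtain ⟨z, h, hz0⟩ := exists_hasPeak_betaSurvival ha ha hS.alpha_pos
  rcases le_or_gt (1 / 2) z with hz | hz
  · exact lt_max_of_lt_left (hS.symmBetaValue_lt_of_jumpMargin_half_nonneg hb hba h hz
      (jumpMargin_nonneg_of_le ha ha h.peak_mem.2 hz0 one_half_pos hz))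
  · exact hS.symmBetaValue_lt_max_of_peak_lt_half hb hba hac h hz

lemma lowerSemicontinuousAt_symmBetaValue (hS : StationaryLoan ρ α δ K)
    (ha : 0 < a) : LowerSemicontinuousAt (symmBetaValue ρ α) a := by
  obtain ⟨z, h, -⟩ := exists_hasPeak_betaSurvival ha ha hS.alpha_pos
  obtain ⟨m₁, -, C, hC, P, -, e, -, hVa, hV⟩ := hS.exists_affine_le_optValue h
  have hG : ∀ y, ContinuousAt (fun c => betaSurvival c c y) a := fun y =>
    (continuousAt_betaSurvival ha ha y).comp (f := fun c => (c, c))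
      (continuousAt_id.prodMk continuousAt_id)
  have hcont : ContinuousAt
      (fun c => P * betaSurvival c c z - C (betaSurvival c c) - e) a :=
    ((continuousAt_const.mul (hG z)).sub
      (continuousAt_apply_of_mem_screeningLosses hC hG)).sub continuousAt_const
  intro v hv
  rw [symmBetaValue, hVa] at hv
  filter_upwards [hcont.eventually_const_lt hv, lt_mem_nhds ha] with c hvc hc
  exact hvc.trans_le (hV _ (isSurvival_betaSurvival hc hc))

lemma exists_forall_symmBetaValue_lt (hS : StationaryLoan ρ α δ K) :
    ∃ a > 0, ∀ b ∈ Set.Ioo 0 a, symmBetaValue ρ α a < symmBetaValue ρ α b := by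
  have hα := hS.alpha_pos
  have hα1 : 0 < 1 + α := by linarith
  refine ⟨1 / (4 * (1 + α)), by positivity, fun b hb =>
    hS.symmBetaValue_lt_of_jumpMargin_half_pos hb.1 hb.2 ?_⟩
  have ha : 0 < 1 / (4 * (1 + α)) := by positivity
  have hf := mul_le_mul_of_nonneg_left
    (betaPDFReal_self_half_le ha ((div_le_one (by positivity)).2 (by linarith))) hα1.le
  have hhalf : (1 + α) * (2 * (1 / (4 * (1 + α)))) = 1 / 2 := by
    field_simp
    norm_num
  rw [jumpMargin_self_half ha]
  linarith

/- Otherwise the values would stay strictly below that of `Beta(1, 1)`, hence below `K / 2`; but in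
the limit of a deterministic income, lending just below the mean earns `K / 2`. -/
lemma not_strictAntiOn_symmBetaValue (hS : StationaryLoan ρ α δ K) :
    ¬ StrictAntiOn (symmBetaValue ρ α) (Set.Ioi 0) := by
  intro hanti
  have h2 : (2 : ℝ) ∈ Set.Ioi 0 := Set.mem_Ioi.2 two_pos
  have hjump : ∀ y ∈ Set.Ioo (0 : ℝ) (1 / 2), K * y ≤ symmBetaValue ρ α 2 := fun y hy => by
    refine le_of_tendsto (f := fun c => K * jumpProfit α (betaSurvival c c) y)
      (x := Filter.atTop) ?_ ?_
    · simpa only [jumpProfit, Real.one_rpow, mul_one] using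
        (((tendsto_betaSurvival_self_atTop hy.2).rpow_const
          (Or.inl one_ne_zero)).const_mul y).const_mul K
    · filter_upwards [Filter.eventually_gt_atTop 2] with c hc
      have hc0 : 0 < c := two_pos.trans hc
      have hle := hS.jump_le_optValue (isSurvival_betaSurvival hc0 hc0) hy.1 hy.1.le
        (by linarith [hy.2]) (by rw [betaSurvival_of_nonpos hc0 hc0 le_rfl]; exact one_pos)
      rw [betaSurvival_of_nonpos hc0 hc0 le_rfl, Real.one_rpow, mul_one] at hle
      exact hle.trans (hanti h2 hc0 hc).le
  have hhalf : K * (1 / 2) ≤ symmBetaValue ρ α 2 := by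
    refine le_of_tendsto (x := nhdsWithin (1 / 2) (Set.Iio (1 / 2)))
      ((continuous_const_mul K).tendsto _ |>.mono_left nhdsWithin_le_nhds) ?_
    filter_upwards [Ioo_mem_nhdsLT one_half_pos] using hjump
  linarith [hS.symmBetaValue_le one_pos, hanti (Set.mem_Ioi.2 one_pos) h2 one_lt_two]

end StationaryLoan

/-! ### U-shaped functions -/

section UShape

variable {X Y : Type*} [LinearOrder Y]

lemma exists_strictAntiOn_Ioo_strictMonoOn_Ioi [ConditionallyCompleteLinearOrder X]
    {f : X → Y} {p : X} (hf : ∀ b a c, p < b → b < a → a < c → f a < max (f b) (f c))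
    (hleft : ∃ a > p, ∀ b ∈ Set.Ioo p a, f a < f b) (hright : ¬ StrictAntiOn f (Set.Ioi p)) :
    ∃ m > p, StrictAntiOn f (Set.Ioo p m) ∧ StrictMonoOn f (Set.Ioi m) := by
  set D : Set X := {a | p < a ∧ ∀ b ∈ Set.Ioo p a, f a < f b}
  have hincr : ∀ a c, p < a → a ∉ D → a < c → f a < f c := fun a c ha haD hac => by
    obtain ⟨b, hb, hfb⟩ : ∃ b ∈ Set.Ioo p a, f b ≤ f a := by
      by_contra! hcon
      exact haD ⟨ha, hcon⟩
    exact (lt_max_iff.1 (hf b a c hb.1 hb.2 hac)).resolve_left hfb.not_gt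
  have hdown : ∀ a b, p < a → a < b → b ∈ D → a ∈ D := fun a b ha hab hb => by
    by_contra haD
    exact (hincr a b ha haD hab).not_gt (hb.2 a ⟨ha, hab⟩)
  obtain ⟨c, hc, hcD⟩ : ∃ c > p, c ∉ D := by
    by_contra! hcon
    exact hright fun a ha b hb hab => (hcon b hb).2 a ⟨ha, hab⟩
  have hbdd : BddAbove D := ⟨c, fun d hd => not_lt.1 fun hcd => hcD (hdown c d hc hcd hd)⟩
  obtain ⟨a₀, ha₀⟩ : D.Nonempty := hleft
  have hpm : p < sSup D := ha₀.1.trans_le (le_csSup hbdd ha₀)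
  refine ⟨sSup D, hpm, fun a ha b hb hab => ?_, fun a ha b _ hab => ?_⟩
  · obtain ⟨d, hd, hbd⟩ := exists_lt_of_lt_csSup ⟨a₀, ha₀⟩ hb.2
    exact (hdown b d hb.1 hbd hd).2 a ⟨ha.1, hab⟩
  · exact hincr a b (hpm.trans ha) (fun haD => (le_csSup hbdd haD).not_gt ha) hab

variable [TopologicalSpace X]

section LinearOrder

variable [LinearOrder X] [DenselyOrdered X] [OrderTopology X] {f : X → Y} {p m : X}

lemma strictAntiOn_Ioc_of_lowerSemicontinuousAt (hanti : StrictAntiOn f (Set.Ioo p m))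
    (hlsc : LowerSemicontinuousAt f m) : StrictAntiOn f (Set.Ioc p m) := by
  have hle : ∀ a ∈ Set.Ioo p m, f m ≤ f a := fun a ha => by
    have := nhdsLT_neBot_of_exists_lt ⟨a, ha.2⟩
    by_contra! hlt
    obtain ⟨c, hc, hac⟩ :=
      (((hlsc _ hlt).filter_mono nhdsWithin_le_nhds).and (Ioo_mem_nhdsLT ha.2)).exists
    exact (hanti ha ⟨ha.1.trans hac.1, hac.2⟩ hac.1).not_gt hc
  intro a ha b hb hab
  obtain ⟨c, hac, hcb⟩ := exists_between hab
  have hc : c ∈ Set.Ioo p m := ⟨ha.1.trans hac, hcb.trans_le hb.2⟩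
  have hca := hanti ⟨ha.1, hac.trans hc.2⟩ hc hac
  rcases hb.2.eq_or_lt with rfl | hbm
  · exact (hle c hc).trans_lt hca
  · exact (hanti hc ⟨hb.1, hbm⟩ hcb).trans hca

lemma strictMonoOn_Ici_of_lowerSemicontinuousAt (hmono : StrictMonoOn f (Set.Ioi m))
    (hlsc : LowerSemicontinuousAt f m) : StrictMonoOn f (Set.Ici m) := by
  have hle : ∀ b ∈ Set.Ioi m, f m ≤ f b := fun b hb => by
    have := nhdsGT_neBot_of_exists_gt ⟨b, hb⟩
    by_contra! hlt
    obtain ⟨c, hc, hcb⟩ :=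
      (((hlsc _ hlt).filter_mono nhdsWithin_le_nhds).and (Ioo_mem_nhdsGT hb)).exists
    exact (hmono hcb.1 hb hcb.2).not_gt hc
  intro a ha b _ hab
  obtain ⟨c, hac, hcb⟩ := exists_between hab
  have hmc : m < c := ha.trans_lt hac
  have hbc := hmono hmc (hmc.trans hcb) hcb
  rcases ha.eq_or_lt with rfl | hma
  · exact (hle c hmc).trans_lt hbc
  · exact (hmono hma hmc hac).trans hbc

end LinearOrder

theorem exists_strictAntiOn_Ioc_strictMonoOn_Ici [ConditionallyCompleteLinearOrder X]
    [DenselyOrdered X] [OrderTopology X] {f : X → Y} {p : X}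
    (hf : ∀ b a c, p < b → b < a → a < c → f a < max (f b) (f c))
    (hlsc : ∀ a > p, LowerSemicontinuousAt f a)
    (hleft : ∃ a > p, ∀ b ∈ Set.Ioo p a, f a < f b) (hright : ¬ StrictAntiOn f (Set.Ioi p)) :
    ∃ m > p, StrictAntiOn f (Set.Ioc p m) ∧ StrictMonoOn f (Set.Ici m) := by
  obtain ⟨m, hm, hanti, hmono⟩ := exists_strictAntiOn_Ioo_strictMonoOn_Ioi hf hleft hright
  exact ⟨m, hm, strictAntiOn_Ioc_of_lowerSemicontinuousAt hanti (hlsc m hm),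
    strictMonoOn_Ici_of_lowerSemicontinuousAt hmono (hlsc m hm)⟩

end UShape

/-! ### The optimal net present value as a function of the income variance -/

theorem exists_strictAntiOn_strictMonoOn_symmBetaValue {ρ α : ℝ} (hρ : ρ ∈ Set.Ioo (0 : ℝ) 1)
    (hα : 0 < α) :
    ∃ m > 0, StrictAntiOn (symmBetaValue ρ α) (Set.Ioc 0 m) ∧
      StrictMonoOn (symmBetaValue ρ α) (Set.Ici m) := by
  obtain ⟨δ, K, hS⟩ := exists_stationaryLoan hρ hα
  exact exists_strictAntiOn_Ioc_strictMonoOn_Ici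
    (fun _ _ _ hb hba hac => hS.symmBetaValue_lt_max hb hba hac)
    (fun _ ha => hS.lowerSemicontinuousAt_symmBetaValue ha)
    hS.exists_forall_symmBetaValue_lt hS.not_strictAntiOn_symmBetaValue

lemma strictAntiOn_incomeVar : StrictAntiOn incomeVar (Set.Ioi 0) := fun a ha b hb hab => by
  have ha' : (0 : ℝ) < a := ha
  rw [incomeVar, incomeVar, symmBeta, symmBeta, variance_id_betaMeasure_self ha,
    variance_id_betaMeasure_self hb]
  gcongr

lemma incomeVar_mem_Ioo {a : ℝ} (ha : 0 < a) : incomeVar a ∈ Set.Ioo (0 : ℝ) (1 / 4) := by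
  rw [incomeVar, symmBeta, variance_id_betaMeasure_self ha]
  exact ⟨by positivity, one_div_lt_one_div_of_lt four_pos (by linarith)⟩

theorem proposition3_general (ρ α : ℝ) (hρ : ρ ∈ Set.Ioo (0 : ℝ) 1) (hα : 0 < α) :
    (∀ a : ℝ, 0 < a →
      ∫ θ, θ ∂(symmBeta a) = 1 / 2 ∧
      incomeVar a = 1 / (4 * (2 * a + 1)) ∧
      (∀ p : LendingPolicy ρ,
        Summable (fun t => p.cashFlow (constElasticityDemand α) (symmBeta a) t)) ∧
      IsGreatest
        (Set.range fun p : LendingPolicy ρ =>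
          p.expectedNPV (constElasticityDemand α) (symmBeta a))
        (optimalNPV ρ (constElasticityDemand α) (symmBeta a))) ∧
    ∃ v₀ ∈ Set.Ioo (0 : ℝ) (1 / 4), ∀ a b : ℝ, 0 < a → 0 < b → incomeVar a < incomeVar b →
      (incomeVar b ≤ v₀ →
        optimalNPV ρ (constElasticityDemand α) (symmBeta b) <
          optimalNPV ρ (constElasticityDemand α) (symmBeta a)) ∧
      (v₀ ≤ incomeVar a →
        optimalNPV ρ (constElasticityDemand α) (symmBeta a) <
          optimalNPV ρ (constElasticityDemand α) (symmBeta b)) := by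
  obtain ⟨δ, K, hS⟩ := exists_stationaryLoan hρ hα
  have hvalue : ∀ a, 0 < a → optimalNPV ρ (constElasticityDemand α) (symmBeta a)
      = symmBetaValue ρ α a := fun a ha =>
    have : IsProbabilityMeasure (symmBeta a) := isProbabilityMeasureBeta ha ha
    optimalNPV_eq_optValue hS.isLendingMarket (isSurvival_betaSurvival ha ha)
  refine ⟨fun a ha => ?_, ?_⟩
  · have : IsProbabilityMeasure (symmBeta a) := isProbabilityMeasureBeta ha ha
    have hG : IsSurvival (survival (symmBeta a)) := isSurvival_betaSurvival ha ha
    exact ⟨integral_id_betaMeasure_self ha, variance_id_betaMeasure_self ha,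
      LendingPolicy.summable_cashFlow hS.isLendingMarket hG, hvalue a ha ▸
        LendingPolicy.isGreatest_optValue hS.isLendingMarket hG⟩
  · obtain ⟨m, hm, hanti, hmono⟩ := exists_strictAntiOn_strictMonoOn_symmBetaValue hρ hα
    refine ⟨incomeVar m, incomeVar_mem_Ioo hm, fun a b ha hb hab => ?_⟩
    have hba : b < a := (strictAntiOn_incomeVar.lt_iff_gt ha hb).1 hab
    rw [hvalue a ha, hvalue b hb]
    refine ⟨fun hbm => ?_, fun hma => ?_⟩
    · have hmb : m ≤ b := (strictAntiOn_incomeVar.le_iff_ge hb hm).1 hbm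
      exact hmono hmb (hmb.trans hba.le) hba
    · have ham : a ≤ m := (strictAntiOn_incomeVar.le_iff_ge hm ha).1 hma
      exact hanti ⟨hb, hba.le.trans ham⟩ ⟨ha, ham⟩ hba

theorem proposition3 (ρ α : ℝ) (hρ : ρ ∈ Set.Ioo (0 : ℝ) 1) (hα : α ∈ Set.Ioo (0 : ℝ) 1) :
    -- the mean, the variance, and the existence of the maximum that defines the optimal NPV
    (∀ a : ℝ, 0 < a →
      ∫ θ, θ ∂(symmBeta a) = 1 / 2 ∧
      incomeVar a = 1 / (4 * (2 * a + 1)) ∧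
      (∀ p : LendingPolicy ρ,
        Summable (fun t => p.cashFlow (constElasticityDemand α) (symmBeta a) t)) ∧
      IsGreatest
        (Set.range fun p : LendingPolicy ρ =>
          p.expectedNPV (constElasticityDemand α) (symmBeta a))
        (optimalNPV ρ (constElasticityDemand α) (symmBeta a))) ∧
    -- as the variance increases, the optimal NPV first decreases and then increases
    ∃ v₀ ∈ Set.Ioo (0 : ℝ) (1 / 4), ∀ a b : ℝ, 0 < a → 0 < b → incomeVar a < incomeVar b →
      (incomeVar b ≤ v₀ →
        optimalNPV ρ (constElasticityDemand α) (symmBeta b) <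
          optimalNPV ρ (constElasticityDemand α) (symmBeta a)) ∧
      (v₀ ≤ incomeVar a →
        optimalNPV ρ (constElasticityDemand α) (symmBeta a) <
          optimalNPV ρ (constElasticityDemand α) (symmBeta b)) :=
  proposition3_general ρ α hρ hα.1
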